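/- Let $C$ and $S$ be nonempty finite sets (customer types and server types) and $E\subset C\times S$ such that the bipartite graph $(C,S,E)$ is connected. Let $\mu$ be a probability measure on $C\times S$ whose marginals $\mu_C$ and $\mu_S$ satisfy $\operatorname{supp}(\mu_C)=C$ and $\operatorname{supp}(\mu_S)=S$. For $U\subset C$ and $V\subset S$ put $S(U)=\{s\in S:\exists c\in U,\ (c,s)\in E\}$ and $C(V)=\{c\in C:\exists s\in V,\ (c,s)\in E\}$. The pair $(\mu_C,\mu_S)$ satisfies NCond if $$\mu_C(U)<\mu_S(S(U))\ \text{ for all } \emptyset\neq U\subsetneq C,\qquad \mu_S(V)<\mu_C(C(V))\ \text{ for all } \emptyset\neq V\subsetneq S .$$ Proposition. There is an algorithm of time complexity $O((|C|+|S|)^3)$ that, given such a bipartite model $[(C,S,E),\mu]$, decides whether $(\mu_C,\mu_S)$ satisfies NCond. The same holds when the input is $(C,S,E)$ together with an arbitrary pair of probability measures $\mu_C$ on $C$ and $\mu_S$ on $S$ with full supports, instead of $\mu$. Here an algorithm is a single program, and the constant in the $O$ is a single constant, for all inputs. The machine is a random access machine with integer and real memory cells in which every elementary operation costs one step: reading and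 writing cells (with indirect addressing), addition, (truncated) subtraction and comparison of nonnegative integers, and addition, subtraction and comparison of real numbers, with the real constants $0$ and $1$ only; there is no multiplication, and no rounding of reals to integers. The input consists of $|C|$, $|S|$, the adjacency matrix of $E$ (for an arbitrary numbering of $C$ and $S$) and the real point masses of the measures. -/

import Mathlib

/-! ## Bipartite matching models and the conditions NCond -/

/-- The (undirected) bipartite graph on the disjoint union of `C` and `S` with edge set `E`. -/
def bipartiteGraph {C S : Type*} (E : Set (C × S)) : SimpleGraph (C ⊕ S) :=
  SimpleGraph.fromRel fun x y => ∃ c s, x = Sum.inl c ∧ y = Sum.inr s ∧ (c, s) ∈ E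

/-- A bipartite matching structure `(C, S, E, F)`: nonempty finite sets `C` of customer types and
`S` of server types, a connected matching graph `(C, S, E)`, and an arrival graph `(C, S, F)`
without isolated vertices. -/
structure BipartiteMatchingStructure (C S : Type*) [Fintype C] [Fintype S] where
  E : Set (C × S)
  F : Set (C × S)
  nonempty_C : Nonempty C
  nonempty_S : Nonempty S
  connected : (bipartiteGraph E).Connected
  F_left : ∀ c, ∃ s, (c, s) ∈ F
  F_right : ∀ s, ∃ c, (c, s) ∈ F

/-- The first marginal of a weight function on `C × S`. -/
def marginalC {C S : Type*} [Fintype S] (μ : C × S → ℝ) (c : C) : ℝ := ∑ s, μ (c, s)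

/-- The second marginal of a weight function on `C × S`. -/
def marginalS {C S : Type*} [Fintype C] (μ : C × S → ℝ) (s : S) : ℝ := ∑ c, μ (c, s)

/-- A bipartite matching model `[(C, S, E, F), μ]`: a probability measure `μ` on `C × S` (given by
its point masses) with support `F`, whose marginals have full support. The matching policy plays
no role in NCond and is left out. -/
structure BipartiteMatchingModel (C S : Type*) [Fintype C] [Fintype S] extends
    BipartiteMatchingStructure C S where
  μ : C × S → ℝ
  μ_mem : μ ∈ stdSimplex ℝ (C × S)
  support_μ : Function.support μ = F
  support_marginalC : Function.support (marginalC μ) = Set.univ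
  support_marginalS : Function.support (marginalS μ) = Set.univ

open Classical in
/-- `S(U)`: the server types that can be matched with some customer type in `U`. -/
noncomputable def serversOf {C S : Type*} [Fintype S] (E : Set (C × S)) (U : Finset C) :
    Finset S :=
  Finset.univ.filter fun s => ∃ c ∈ U, (c, s) ∈ E

open Classical in
/-- `C(V)`: the customer types that can be matched with some server type in `V`. -/
noncomputable def customersOf {C S : Type*} [Fintype C] (E : Set (C × S)) (V : Finset S) :
    Finset C :=
  Finset.univ.filter fun c => ∃ s ∈ V, (c, s) ∈ E

/-- The conditions NCond on a pair of weight functions `p` on `C` and `q` on `S`: strict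
inequalities for all nonempty proper subsets `U` of `C` and `V` of `S`. -/
def NCond {C S : Type*} [Fintype C] [Fintype S] (E : Set (C × S)) (p : C → ℝ) (q : S → ℝ) :
    Prop :=
  (∀ U : Finset C, U.Nonempty → U ≠ Finset.univ → ∑ c ∈ U, p c < ∑ s ∈ serversOf E U, q s) ∧
  (∀ V : Finset S, V.Nonempty → V ≠ Finset.univ → ∑ s ∈ V, q s < ∑ c ∈ customersOf E V, p c)

/-! ## A real random access machine with unit costs

The memory consists of integer variables, integer arrays and real arrays. Programs are structured
(assignment, sequence, conditional, while loop); a program is a finite object and names only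
finitely many variables and arrays. Every read, constant, operation, test and write costs one
step. On integers there are only addition and truncated subtraction (no multiplication, so
unit cost is the usual convention of Cook and Reckhow); on reals there are only the constants
`0` and `1`, addition, subtraction and comparison. There is no rounding of reals to integers. -/

namespace RealRAM

/-- Memory contents: integer variables, integer arrays, real arrays. Variables and arrays are
named by natural numbers; `ints a i` is the cell number `i` of the array `a`. -/
structure State where
  vars : ℕ → ℕ
  ints : ℕ → ℕ → ℕ
  reals : ℕ → ℕ → ℝ

/-- Integer expressions. -/
inductive IExp where
  | lit (k : ℕ)
  | var (x : ℕ)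
  | get (a : ℕ) (i : IExp)
  | add (e₁ e₂ : IExp)
  | sub (e₁ e₂ : IExp)

/-- Value of an integer expression. -/
def IExp.eval (σ : State) : IExp → ℕ
  | .lit k => k
  | .var x => σ.vars x
  | .get a i => σ.ints a (i.eval σ)
  | .add e₁ e₂ => e₁.eval σ + e₂.eval σ
  | .sub e₁ e₂ => e₁.eval σ - e₂.eval σ

/-- Number of steps of the evaluation of an integer expression. -/
def IExp.cost : IExp → ℕ
  | .lit _ => 1
  | .var _ => 1
  | .get _ i => i.cost + 1
  | .add e₁ e₂ => e₁.cost + e₂.cost + 1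
  | .sub e₁ e₂ => e₁.cost + e₂.cost + 1

/-- Real expressions. -/
inductive RExp where
  | zero
  | one
  | get (a : ℕ) (i : IExp)
  | add (e₁ e₂ : RExp)
  | sub (e₁ e₂ : RExp)

/-- Value of a real expression. -/
noncomputable def RExp.eval (σ : State) : RExp → ℝ
  | .zero => 0
  | .one => 1
  | .get a i => σ.reals a (i.eval σ)
  | .add e₁ e₂ => e₁.eval σ + e₂.eval σ
  | .sub e₁ e₂ => e₁.eval σ - e₂.eval σ

/-- Number of steps of the evaluation of a real expression. -/
def RExp.cost : RExp → ℕ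
  | .zero => 1
  | .one => 1
  | .get _ i => i.cost + 1
  | .add e₁ e₂ => e₁.cost + e₂.cost + 1
  | .sub e₁ e₂ => e₁.cost + e₂.cost + 1

/-- Tests: comparisons of integers and of reals, and their Boolean combinations. -/
inductive Test where
  | ile (e₁ e₂ : IExp)
  | rle (e₁ e₂ : RExp)
  | neg (b : Test)
  | conj (b₁ b₂ : Test)

/-- Truth of a test. -/
def Test.Holds (σ : State) : Test → Prop
  | .ile e₁ e₂ => e₁.eval σ ≤ e₂.eval σ
  | .rle e₁ e₂ => e₁.eval σ ≤ e₂.eval σ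
  | .neg b => ¬ b.Holds σ
  | .conj b₁ b₂ => b₁.Holds σ ∧ b₂.Holds σ

/-- Number of steps of a test. -/
def Test.cost : Test → ℕ
  | .ile e₁ e₂ => e₁.cost + e₂.cost + 1
  | .rle e₁ e₂ => e₁.cost + e₂.cost + 1
  | .neg b => b.cost + 1
  | .conj b₁ b₂ => b₁.cost + b₂.cost + 1

/-- Programs. `setVar x e` is `x := e`, `setInt a i e` and `setReal a i e` are `a[i] := e`. -/
inductive Program where
  | skip
  | setVar (x : ℕ) (e : IExp)
  | setInt (a : ℕ) (i e : IExp)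
  | setReal (a : ℕ) (i : IExp) (e : RExp)
  | seq (P Q : Program)
  | branch (b : Test) (P Q : Program)
  | loop (b : Test) (P : Program)

/-- Write `v` to the integer variable `x`. -/
def State.putVar (σ : State) (x v : ℕ) : State :=
  { σ with vars := Function.update σ.vars x v }

/-- Write `v` to the cell `i` of the integer array `a`. -/
def State.putInt (σ : State) (a i v : ℕ) : State :=
  { σ with ints := Function.update σ.ints a (Function.update (σ.ints a) i v) }

/-- Write `v` to the cell `i` of the real array `a`. -/
noncomputable def State.putReal (σ : State) (a i : ℕ) (v : ℝ) : State :=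
  { σ with reals := Function.update σ.reals a (Function.update (σ.reals a) i v) }

/-- `Exec P σ t τ`: the program `P`, started with memory `σ`, halts after exactly `t` steps with
memory `τ`. -/
inductive Exec : Program → State → ℕ → State → Prop where
  | skip (σ : State) : Exec .skip σ 1 σ
  | setVar (σ : State) (x : ℕ) (e : IExp) :
      Exec (.setVar x e) σ (e.cost + 1) (σ.putVar x (e.eval σ))
  | setInt (σ : State) (a : ℕ) (i e : IExp) :
      Exec (.setInt a i e) σ (i.cost + e.cost + 1) (σ.putInt a (i.eval σ) (e.eval σ))
  | setReal (σ : State) (a : ℕ) (i : IExp) (e : RExp) :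
      Exec (.setReal a i e) σ (i.cost + e.cost + 1) (σ.putReal a (i.eval σ) (e.eval σ))
  | seq {P Q : Program} {σ τ ρ : State} {t u : ℕ} :
      Exec P σ t τ → Exec Q τ u ρ → Exec (.seq P Q) σ (t + u) ρ
  | branch_true {b : Test} {P Q : Program} {σ τ : State} {t : ℕ} :
      b.Holds σ → Exec P σ t τ → Exec (.branch b P Q) σ (b.cost + 1 + t) τ
  | branch_false {b : Test} {P Q : Program} {σ τ : State} {t : ℕ} :
      ¬ b.Holds σ → Exec Q σ t τ → Exec (.branch b P Q) σ (b.cost + 1 + t) τ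
  | loop_false {b : Test} {P : Program} {σ : State} :
      ¬ b.Holds σ → Exec (.loop b P) σ (b.cost + 1) σ
  | loop_true {b : Test} {P : Program} {σ τ ρ : State} {t u : ℕ} :
      b.Holds σ → Exec P σ t τ → Exec (.loop b P) τ u ρ →
        Exec (.loop b P) σ (b.cost + 1 + t + u) ρ

/-- The machine is deterministic: final memory and running time are unique. -/
theorem Exec.unique {P : Program} {σ τ τ' : State} {t t' : ℕ}
    (h : Exec P σ t τ) (h' : Exec P σ t' τ') : t = t' ∧ τ = τ' := by
  induction h generalizing t' τ' with
  | skip => cases h'; exact ⟨rfl, rfl⟩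
  | setVar => cases h'; exact ⟨rfl, rfl⟩
  | setInt => cases h'; exact ⟨rfl, rfl⟩
  | setReal => cases h'; exact ⟨rfl, rfl⟩
  | seq _ _ ih₁ ih₂ =>
    cases h' with
    | seq k₁ k₂ =>
      obtain ⟨rfl, rfl⟩ := ih₁ k₁
      obtain ⟨rfl, rfl⟩ := ih₂ k₂
      exact ⟨rfl, rfl⟩
  | branch_true hb _ ih =>
    cases h' with
    | branch_true _ k => obtain ⟨rfl, rfl⟩ := ih k; exact ⟨rfl, rfl⟩
    | branch_false hb' _ => exact absurd hb hb'
  | branch_false hb _ ih =>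
    cases h' with
    | branch_true hb' _ => exact absurd hb' hb
    | branch_false _ k => obtain ⟨rfl, rfl⟩ := ih k; exact ⟨rfl, rfl⟩
  | loop_false hb =>
    cases h' with
    | loop_false _ => exact ⟨rfl, rfl⟩
    | loop_true hb' _ _ => exact absurd hb' hb
  | loop_true hb _ _ ih₁ ih₂ =>
    cases h' with
    | loop_false hb' => exact absurd hb hb'
    | loop_true _ k₁ k₂ =>
      obtain ⟨rfl, rfl⟩ := ih₁ k₁
      obtain ⟨rfl, rfl⟩ := ih₂ k₂
      exact ⟨rfl, rfl⟩

/-- Started with memory `σ`, the program `P` halts within `T` steps and leaves the correct answer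
to the question `φ` in variable `0`: `1` for yes, `0` for no. -/
def Program.DecidesWithin (P : Program) (σ : State) (T : ℕ) (φ : Prop) : Prop :=
  ∃ t τ, Exec P σ t τ ∧ t ≤ T ∧ ((φ ∧ τ.vars 0 = 1) ∨ (¬ φ ∧ τ.vars 0 = 0))

/-- A finite vector as the contents of an array, followed by zeros. -/
def vec {α : Type*} [Zero α] {n : ℕ} (f : Fin n → α) (k : ℕ) : α :=
  if h : k < n then f ⟨k, h⟩ else 0

/-- An `n × m` matrix as the contents of an array, row by row: the entry `(i, j)` is stored in
the cell `i * m + j`. -/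
def mat {α : Type*} [Zero α] {n m : ℕ} (f : Fin n → Fin m → α) : ℕ → α :=
  vec fun k : Fin (n * m) => f (finProdFinEquiv.symm k).1 (finProdFinEquiv.symm k).2

open Classical in
/-- The memory that holds a matching graph `(C, S, E)` with numbered types and prescribed real
arrays: `|C|` and `|S|` are in the variables `0` and `1`, the 0-1 adjacency matrix of `E` is in
the integer array `0`, and all other integer cells are zero. -/
noncomputable def graphInput {C S : Type*} [Fintype C] [Fintype S]
    (eC : Fin (Fintype.card C) ≃ C) (eS : Fin (Fintype.card S) ≃ S)
    (E : Set (C × S)) (reals : ℕ → ℕ → ℝ) : State where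
  vars
    | 0 => Fintype.card C
    | 1 => Fintype.card S
    | _ => 0
  ints
    | 0 => mat fun i j => if (eC i, eS j) ∈ E then 1 else 0
    | _ => 0
  reals := reals

/-- Input given by the matching graph and the two marginals: `p` in the real array `0`,
`q` in the real array `1`. -/
noncomputable def marginalInput {C S : Type*} [Fintype C] [Fintype S]
    (eC : Fin (Fintype.card C) ≃ C) (eS : Fin (Fintype.card S) ≃ S)
    (E : Set (C × S)) (p : C → ℝ) (q : S → ℝ) : State :=
  graphInput eC eS E fun
    | 0 => vec fun i => p (eC i)
    | 1 => vec fun j => q (eS j)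
    | _ => 0

/-- Input given by the matching graph and the law `μ` on `C × S`: the matrix of `μ` in the
real array `2`. -/
noncomputable def jointInput {C S : Type*} [Fintype C] [Fintype S]
    (eC : Fin (Fintype.card C) ≃ C) (eS : Fin (Fintype.card S) ≃ S)
    (E : Set (C × S)) (μ : C × S → ℝ) : State :=
  graphInput eC eS E fun
    | 2 => mat fun i j => μ (eC i, eS j)
    | _ => 0

end RealRAM

/-! NCond is a property of a transportation network. Let customer types supply `p`, let server types
demand `q`, and give every edge capacity 2, more than the total mass 1. For the residual capacities
of any flow, the total excess of a vertex set `X` is its supply minus the net flow out of it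
(`sum_excess_eq`). If `X` is closed in the residual graph, the arcs leaving it are saturated; if
moreover no vertex of `X` has a deficit, no edge can leave `X`, so its server part contains `S(U)`,
where `U` is its customer part, and it demands at most what `U` supplies. Unless `X` is trivial,
this contradicts NCond (`not_nCond_of_closed`). Conversely, if all excesses vanish and the residual
graph is strongly connected, the same identity for `U ∪ S(U)` shows that `q(S(U)) - p(U)` is a
positive residual capacity (`nCond_of_strongly_connected`). So NCond holds if and only if some flow
meets all demands and has a strongly connected residual graph.

The flow is found by push-relabel without source or sink. Vertices with a deficit keep label 0; an
active vertex (one with positive excess) whose label reaches the number `N` of vertices yields a gap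
in the labels, hence a closed set that refutes NCond (`Labelled.exists_closed`). The running time
does not depend on the real data. Vertices are treated in sweeps, each until its excess is gone. A
sweep lowers the bound `H` on active labels by one and a relabelling raises it by one; since there
are at most `N²` relabellings, there are `O(N²)` sweeps of `N` vertices. The scans of arcs cost
`O(N)` per relabelling. The potential `remaining` combines these counts. Two searches from vertex 0,
along the residual arcs and against them, then test strong connectivity.

All loop bodies are loop-free, so total correctness of each loop reduces to an invariant indexed by
a decreasing natural number (`Program.LoopFree.loop_reaches`). -/

/-! ## Verification of programs -/

namespace RealRAM

/-- Programs without loops. -/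
def Program.LoopFree : Program → Prop
  | .seq P Q => P.LoopFree ∧ Q.LoopFree
  | .branch _ P Q => P.LoopFree ∧ Q.LoopFree
  | .loop _ _ => False
  | _ => True

open Classical in
/-- The final memory of a loop-free program. -/
noncomputable def Program.run : Program → State → State
  | .skip, σ => σ
  | .setVar x e, σ => σ.putVar x (e.eval σ)
  | .setInt a i e, σ => σ.putInt a (i.eval σ) (e.eval σ)
  | .setReal a i e, σ => σ.putReal a (i.eval σ) (e.eval σ)
  | .seq P Q, σ => Q.run (P.run σ)
  | .branch b P Q, σ => if b.Holds σ then P.run σ else Q.run σ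
  | .loop _ _, σ => σ

/-- An upper bound for the running time of a loop-free program. -/
def Program.time : Program → ℕ
  | .skip => 1
  | .setVar _ e => e.cost + 1
  | .setInt _ i e => i.cost + e.cost + 1
  | .setReal _ i e => i.cost + e.cost + 1
  | .seq P Q => P.time + Q.time
  | .branch b P Q => b.cost + 1 + (P.time + Q.time)
  | .loop _ _ => 0

theorem Program.LoopFree.exec {P : Program} (hP : P.LoopFree) (σ : State) :
    ∃ t, Exec P σ t (P.run σ) ∧ t ≤ P.time := by
  induction P generalizing σ with
  | skip => exact ⟨_, .skip σ, le_rfl⟩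
  | setVar x e => exact ⟨_, .setVar σ x e, le_rfl⟩
  | setInt a i e => exact ⟨_, .setInt σ a i e, le_rfl⟩
  | setReal a i e => exact ⟨_, .setReal σ a i e, le_rfl⟩
  | seq P Q ihP ihQ =>
    obtain ⟨t, ht, ht'⟩ := ihP hP.1 σ
    obtain ⟨u, hu, hu'⟩ := ihQ hP.2 (P.run σ)
    exact ⟨_, .seq ht hu, Nat.add_le_add ht' hu'⟩
  | branch b P Q ihP ihQ =>
    by_cases hb : b.Holds σ
    · obtain ⟨t, ht, ht'⟩ := ihP hP.1 σ
      refine ⟨_, ?_, Nat.add_le_add_left (ht'.trans (Nat.le_add_right _ Q.time)) _⟩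
      simpa [Program.run, hb] using Exec.branch_true hb ht
    · obtain ⟨t, ht, ht'⟩ := ihQ hP.2 σ
      refine ⟨_, ?_, Nat.add_le_add_left (ht'.trans (Nat.le_add_left _ P.time)) _⟩
      simpa [Program.run, hb] using Exec.branch_false hb ht
  | loop b P => exact hP.elim

/-- `P.Reaches σ T Q`: started with memory `σ`, the program `P` halts within `T` steps with a
memory that satisfies `Q`. -/
def Program.Reaches (P : Program) (σ : State) (T : ℕ) (Q : State → Prop) : Prop :=
  ∃ t τ, Exec P σ t τ ∧ t ≤ T ∧ Q τ

theorem Program.LoopFree.reaches {P : Program} (hP : P.LoopFree) {σ : State} {Q : State → Prop}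
    (h : Q (P.run σ)) : P.Reaches σ P.time Q :=
  let ⟨t, ht, ht'⟩ := hP.exec σ
  ⟨t, _, ht, ht', h⟩

theorem Program.Reaches.seq {P P' : Program} {σ : State} {T T' : ℕ} {Q Q' : State → Prop}
    (h : P.Reaches σ T Q) (h' : ∀ τ, Q τ → P'.Reaches τ T' Q') :
    (Program.seq P P').Reaches σ (T + T') Q' := by
  obtain ⟨t, τ, ht, htT, hτ⟩ := h
  obtain ⟨u, ρ, hu, huT, hρ⟩ := h' τ hτ
  exact ⟨_, ρ, .seq ht hu, Nat.add_le_add htT huT, hρ⟩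

/-- A loop with a loop-free body terminates when each round preserves an invariant and decreases
a natural number. -/
theorem Program.LoopFree.loop_reaches {b : Test} {P : Program} (hP : P.LoopFree)
    {I : ℕ → State → Prop}
    (step : ∀ k σ, I k σ → b.Holds σ → ∃ k' < k, I k' (P.run σ)) {k : ℕ} {σ : State}
    (h : I k σ) :
    (Program.loop b P).Reaches σ ((k + 1) * (b.cost + 1 + P.time))
      fun τ => ¬ b.Holds τ ∧ ∃ k', I k' τ := by
  induction k using Nat.strong_induction_on generalizing σ with
  | _ k ih =>
    by_cases hb : b.Holds σ
    · obtain ⟨k', hk', h'⟩ := step k σ h hb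
      obtain ⟨t, ht, htP⟩ := hP.exec σ
      obtain ⟨u, τ, hu, huT, hτ⟩ := ih k' hk' h'
      refine ⟨_, τ, .loop_true hb ht hu, ?_, hτ⟩
      have : (k' + 1) * (b.cost + 1 + P.time) ≤ k * (b.cost + 1 + P.time) :=
        Nat.mul_le_mul_right _ hk'
      rw [Nat.add_mul k 1]
      omega
    · refine ⟨_, σ, .loop_false hb, ?_, hb, k, h⟩
      rw [Nat.add_mul]
      omega

/-! ### Reading memory after a write -/

@[simp] theorem State.vars_putVar (σ : State) (x v y : ℕ) :
    (σ.putVar x v).vars y = if y = x then v else σ.vars y := by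
  simp [State.putVar, Function.update_apply]
@[simp] theorem State.ints_putVar (σ : State) (x v : ℕ) : (σ.putVar x v).ints = σ.ints := rfl
@[simp] theorem State.reals_putVar (σ : State) (x v : ℕ) : (σ.putVar x v).reals = σ.reals := rfl
@[simp] theorem State.vars_putInt (σ : State) (a i v : ℕ) : (σ.putInt a i v).vars = σ.vars := rfl
@[simp] theorem State.ints_putInt (σ : State) (a i v c : ℕ) :
    (σ.putInt a i v).ints c = if c = a then Function.update (σ.ints c) i v else σ.ints c := by
  simp only [State.putInt, Function.update_apply]
  split_ifs with h
  · rw [h]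
  · rfl
@[simp] theorem State.reals_putInt (σ : State) (a i v : ℕ) :
    (σ.putInt a i v).reals = σ.reals := rfl
@[simp] theorem State.vars_putReal (σ : State) (a i : ℕ) (v : ℝ) :
    (σ.putReal a i v).vars = σ.vars := rfl
@[simp] theorem State.ints_putReal (σ : State) (a i : ℕ) (v : ℝ) :
    (σ.putReal a i v).ints = σ.ints := rfl
@[simp] theorem State.reals_putReal (σ : State) (a i : ℕ) (v : ℝ) (c : ℕ) :
    (σ.putReal a i v).reals c =
      if c = a then Function.update (σ.reals c) i v else σ.reals c := by
  simp only [State.putReal, Function.update_apply]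
  split_ifs with h
  · rw [h]
  · rfl

end RealRAM

/-! ## The push-relabel method -/

/-- Invariants of the push-relabel method on the vertices `0, …, N - 1`: with supplies `b` and
capacities `r₀`, the residual capacities `r` and the excesses `e` come from a flow, the labels `d`
are valid, vertices with a deficit have label `0`, and the arcs of `v` to the vertices below
`cur v` are not admissible. -/
structure Labelled (N : ℕ) (b : ℕ → ℝ) (r₀ : ℕ → ℕ → ℝ) (e : ℕ → ℝ) (r : ℕ → ℕ → ℝ)
    (d cur : ℕ → ℕ) : Prop where
  nonneg : ∀ v < N, ∀ w < N, 0 ≤ r v w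
  symm : ∀ v < N, ∀ w < N, r v w + r w v = r₀ v w + r₀ w v
  excess : ∀ v < N, e v = b v - ∑ w ∈ Finset.range N, (r₀ v w - r v w)
  valid : ∀ v < N, ∀ w < N, 0 < r v w → d v ≤ d w + 1
  deficit : ∀ v < N, e v < 0 → d v = 0
  cur_le : ∀ v < N, cur v ≤ N
  current : ∀ v < N, ∀ w < cur v, 0 < r v w → d v ≤ d w

namespace Labelled

variable {N : ℕ} {b : ℕ → ℝ} {r₀ : ℕ → ℕ → ℝ} {e e' : ℕ → ℝ} {r r' : ℕ → ℕ → ℝ} {d cur : ℕ → ℕ}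

theorem advance (h : Labelled N b r₀ e r d cur) {v : ℕ} (hv : cur v < N)
    (hc : 0 < r v (cur v) → d v ≤ d (cur v)) :
    Labelled N b r₀ e r d (Function.update cur v (cur v + 1)) where
  nonneg := h.nonneg
  symm := h.symm
  excess := h.excess
  valid := h.valid
  deficit := h.deficit
  cur_le u hu := by
    rcases eq_or_ne u v with rfl | huv
    · simpa using hv
    · simpa [huv] using h.cur_le u hu
  current u hu w hw := by
    rcases eq_or_ne u v with rfl | huv
    · rw [Function.update_self] at hw
      rcases (Nat.lt_succ_iff.1 hw).eq_or_lt with rfl | hw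
      · exact hc
      · exact h.current u hu w hw
    · rw [Function.update_of_ne huv] at hw
      exact h.current u hu w hw

/-- The pointer of `v` has passed all its arcs, so `current` gives `d v ≤ d w` on every residual arc
out of `v`, which leaves room for one unit in `valid`. For the other vertices a larger label at the
head of an arc only helps. -/
theorem relabel (h : Labelled N b r₀ e r d cur) {v : ℕ} (hv : v < N) (he : 0 < e v)
    (hc : cur v = N) :
    Labelled N b r₀ e r (Function.update d v (d v + 1)) (Function.update cur v 0) where
  nonneg := h.nonneg
  symm := h.symm
  excess := h.excess
  valid u hu w hw hr := by
    have h₁ := h.valid u hu w hw hr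
    rcases eq_or_ne u v with rfl | huv
    · have := h.current u hu w (hc ▸ hw) hr
      rcases eq_or_ne w u with rfl | hwu
      · simp
      · simpa [hwu] using this
    · rcases eq_or_ne w v with rfl | hwv
      · simp only [Function.update_of_ne huv, Function.update_self]
        omega
      · simpa [huv, hwv] using h₁
  deficit u hu hu' := by
    have huv : u ≠ v := by rintro rfl; exact lt_asymm he hu'
    simpa [huv] using h.deficit u hu hu'
  cur_le u hu := by
    rcases eq_or_ne u v with rfl | huv
    · simp
    · simpa [huv] using h.cur_le u hu
  current u hu w hw hr := by
    rcases eq_or_ne u v with rfl | huv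
    · simp at hw
    · rw [Function.update_of_ne huv] at hw ⊢
      have := h.current u hu w hw hr
      rcases eq_or_ne w v with rfl | hwv
      · rw [Function.update_self]
        omega
      · rwa [Function.update_of_ne hwv]

/-- Only the reverse arc from `w` to `v` can newly enter the residual graph. It leads from label `d
w` up to `d w + 1`, so it is valid and not admissible, and `current` survives even if the pointer of
`w` has already passed `v`. A vertex with a deficit after the push had one before. -/
theorem push (h : Labelled N b r₀ e r d cur) {v w : ℕ} (hv : v < N) (hw : w < N)
    (hd : d v = d w + 1) {δ : ℝ} (hδ : 0 ≤ δ) (hδe : δ ≤ e v) (hδr : δ ≤ r v w)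
    (hev : e' v = e v - δ) (hew : e' w = e w + δ) (he : ∀ u, u ≠ v → u ≠ w → e' u = e u)
    (hrv : r' v w = r v w - δ) (hrw : r' w v = r w v + δ)
    (hr : ∀ x < N, ∀ y < N, ¬ (x = v ∧ y = w) → ¬ (x = w ∧ y = v) → r' x y = r x y) :
    Labelled N b r₀ e' r' d cur := by
  have hvw : v ≠ w := by rintro rfl; omega
  have hpos : ∀ x < N, ∀ y < N, 0 < r' x y → 0 < r x y ∨ (x = w ∧ y = v) := by
    intro x hx y hy hxy
    by_cases h₂ : x = w ∧ y = v
    · exact .inr h₂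
    by_cases h₁ : x = v ∧ y = w
    · obtain ⟨rfl, rfl⟩ := h₁
      left
      linarith
    · rw [hr x hx y hy h₁ h₂] at hxy
      exact .inl hxy
  refine ⟨fun x hx y hy => ?_, fun x hx y hy => ?_, fun x hx => ?_, fun x hx y hy hxy => ?_,
    fun x hx hex => ?_, h.cur_le, fun x hx y hy hxy => ?_⟩
  · have := h.nonneg x hx y hy
    by_cases h₁ : x = v ∧ y = w
    · obtain ⟨rfl, rfl⟩ := h₁
      linarith
    by_cases h₂ : x = w ∧ y = v
    · obtain ⟨rfl, rfl⟩ := h₂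
      linarith
    rwa [hr x hx y hy h₁ h₂]
  · have := h.symm x hx y hy
    by_cases h₁ : x = v ∧ y = w
    · obtain ⟨rfl, rfl⟩ := h₁
      linarith
    by_cases h₂ : x = w ∧ y = v
    · obtain ⟨rfl, rfl⟩ := h₂
      linarith
    rwa [hr x hx y hy h₁ h₂, hr y hy x hx (by tauto) (by tauto)]
  · have hsum : ∑ y ∈ Finset.range N, (r₀ x y - r' x y) =
        ∑ y ∈ Finset.range N, (r₀ x y - r x y) + ∑ y ∈ Finset.range N, (r x y - r' x y) := by
      rw [← Finset.sum_add_distrib]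
      exact Finset.sum_congr rfl fun y _ => by ring
    rw [hsum]
    have hx' := h.excess x hx
    rcases eq_or_ne x v with rfl | hxv
    · have : ∑ y ∈ Finset.range N, (r x y - r' x y) = r x w - r' x w :=
        Finset.sum_eq_single_of_mem w (Finset.mem_range.2 hw) fun y hy hyw => by
          rw [hr x hx y (Finset.mem_range.1 hy) (by tauto) (by tauto), sub_self]
      linarith
    · rcases eq_or_ne x w with rfl | hxw
      · have : ∑ y ∈ Finset.range N, (r x y - r' x y) = r x v - r' x v :=
          Finset.sum_eq_single_of_mem v (Finset.mem_range.2 hv) fun y hy hyv => by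
            rw [hr x hx y (Finset.mem_range.1 hy) (by tauto) (by tauto), sub_self]
        linarith
      · have : ∑ y ∈ Finset.range N, (r x y - r' x y) = 0 := Finset.sum_eq_zero fun y hy => by
          rw [hr x hx y (Finset.mem_range.1 hy) (by tauto) (by tauto), sub_self]
        rw [he x hxv hxw]
        linarith
  · rcases hpos x hx y hy hxy with h₁ | ⟨rfl, rfl⟩
    · exact h.valid x hx y hy h₁
    · omega
  · rcases eq_or_ne x v with rfl | hxv
    · linarith
    · rcases eq_or_ne x w with rfl | hxw
      · exact h.deficit x hx (by linarith)
      · rw [he x hxv hxw] at hex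
        exact h.deficit x hx hex
  · rcases hpos x hx y (hy.trans_le (h.cur_le x hx)) hxy with h₁ | ⟨rfl, rfl⟩
    · exact h.current x hx y hy h₁
    · omega

/-- When a label reaches `N`, some set that is closed in the residual graph contains the vertices
with this label and no vertex with a deficit. -/
theorem exists_closed (h : Labelled N b r₀ e r d cur) {v : ℕ} (hv : v < N) (hd : N ≤ d v) :
    ∃ X : Set ℕ, v ∈ X ∧ (∀ x < N, x ∈ X → 0 ≤ e x) ∧
      ∀ x < N, x ∈ X → ∀ y < N, y ∉ X → r x y = 0 := by
  -- Pigeonhole: truncated at `N`, the labels of `N` vertices miss one of the values `0, …, N`, and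
  -- `N` itself is attained at `v`.
  obtain ⟨k, hk, hk'⟩ : ∃ k < N, ∀ u < N, d u ≠ k := by
    by_contra! hcon
    have h₁ : Finset.range (N + 1) ⊆ (Finset.range N).image fun u => min (d u) N := by
      intro k hk
      rcases (Nat.lt_succ_iff.1 (Finset.mem_range.1 hk)).lt_or_eq with hk | rfl
      · obtain ⟨u, hu, rfl⟩ := hcon k hk
        exact Finset.mem_image.2 ⟨u, Finset.mem_range.2 hu, min_eq_left hk.le⟩
      · exact Finset.mem_image.2 ⟨v, Finset.mem_range.2 hv, min_eq_right hd⟩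
    have := (Finset.card_le_card h₁).trans Finset.card_image_le
    simp at this
  -- A residual arc leaving this set would jump over the gap `k`, dropping the label by at least
  -- two, against `valid`.
  refine ⟨{u | k < d u}, hk.trans_le hd, fun x hx hxk => ?_, fun x hx hxk y hy hyk => ?_⟩
  · by_contra! hneg
    rw [Set.mem_ofPred_eq, h.deficit x hx hneg] at hxk
    omega
  · by_contra hne
    have h₁ := h.valid x hx y hy (lt_of_le_of_ne (h.nonneg x hx y hy) (Ne.symm hne))
    have h₂ := hk' y hy
    simp only [Set.mem_ofPred_eq] at hxk hyk
    omega

end Labelled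

/-- The bookkeeping of one sweep over the vertices: `v` is the vertex under treatment, `a` tells
whether this sweep has pushed anything, and `H` bounds the labels of the active vertices. -/
structure Sweep (N : ℕ) (e : ℕ → ℝ) (d : ℕ → ℕ) (v a H : ℕ) : Prop where
  ahead : ∀ u < N, v ≤ u → 0 < e u → d u ≤ H
  behind : ∀ u < N, u < v → 0 < e u → d u < H
  idle : a = 0 → ∀ u < N, u < v → e u ≤ 0
  busy : a ≠ 0 → 0 < H

namespace Sweep

variable {N : ℕ} {e e' : ℕ → ℝ} {d : ℕ → ℕ} {v w a H : ℕ}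

theorem next (h : Sweep N e d v a H) (hv : e v ≤ 0) : Sweep N e d (v + 1) a H where
  ahead u hu huv := h.ahead u hu (by omega)
  behind u hu huv he := by
    rcases (Nat.lt_succ_iff.1 huv).eq_or_lt with rfl | huv
    · exact absurd he hv.not_gt
    · exact h.behind u hu huv he
  idle ha u hu huv := by
    rcases (Nat.lt_succ_iff.1 huv).eq_or_lt with rfl | huv
    · exact hv
    · exact h.idle ha u hu huv
  busy := h.busy

/-- After a full sweep every vertex lies behind, so the strict bound `behind` becomes the weak bound
`ahead` for the next smaller `H`: each new sweep is paid for by one unit of `H`. -/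
theorem restart (h : Sweep N e d v a (H + 1)) (hv : N ≤ v) : Sweep N e d 0 0 H where
  ahead u hu _ he := Nat.lt_succ_iff.1 (h.behind u hu (hu.trans_le hv) he)
  behind u hu huv := by omega
  idle _ u _ huv := by omega
  busy := by simp

theorem relabel (h : Sweep N e d v a H) (hv : v < N) (he : 0 < e v) :
    Sweep N e (Function.update d v (d v + 1)) v a (H + 1) where
  ahead u hu huv heu := by
    rcases eq_or_ne u v with rfl | huv'
    · simpa using h.ahead u hu le_rfl heu
    · simpa [huv'] using (h.ahead u hu huv heu).trans (Nat.le_succ H)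
  behind u hu huv heu := by
    simpa [huv.ne] using (h.behind u hu huv heu).trans (Nat.lt_succ_self H)
  idle := h.idle
  busy _ := H.succ_pos

/-- The head `w` may become active behind the sweep, but its label is `d v - 1 < H`, exactly what
`behind` requires. -/
theorem push (h : Sweep N e d v a H) (hv : v < N) (he : 0 < e v) (hd : d v = d w + 1)
    (hev : e' v ≤ e v) (he' : ∀ u, u ≠ v → u ≠ w → e' u = e u) : Sweep N e' d v 1 H where
  ahead u hu huv heu := by
    have := h.ahead v hv le_rfl he
    rcases eq_or_ne u v with rfl | huv'
    · exact this
    · rcases eq_or_ne u w with rfl | huw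
      · omega
      · exact h.ahead u hu huv (he' u huv' huw ▸ heu)
  behind u hu huv heu := by
    have := h.ahead v hv le_rfl he
    rcases eq_or_ne u w with rfl | huw
    · omega
    · exact h.behind u hu huv (he' u huv.ne huw ▸ heu)
  idle := by simp
  busy _ := by
    have := h.ahead v hv le_rfl he
    omega

end Sweep

/-- A bound for the number of remaining rounds of the push-relabel method. -/
def remaining (N : ℕ) (d cur : ℕ → ℕ) (v H : ℕ) : ℕ :=
  ∑ u ∈ Finset.range N, (2 * ((N + 1) * (N - d u)) + (N - cur u)) + (N + 1) * H + (N - v)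

theorem remaining_next {N v : ℕ} (d cur : ℕ → ℕ) (H : ℕ) (hv : v < N) :
    remaining N d cur (v + 1) H < remaining N d cur v H := by
  unfold remaining
  omega

/-- Going back to the first vertex costs `N`, one less than the weight `N + 1` of a unit of `H`. -/
theorem remaining_restart {N v : ℕ} (d cur : ℕ → ℕ) (H : ℕ) (hv : N ≤ v) :
    remaining N d cur 0 H < remaining N d cur v (H + 1) := by
  unfold remaining
  rw [Nat.mul_succ]
  omega

theorem remaining_advance {N v : ℕ} (d : ℕ → ℕ) {cur : ℕ → ℕ} (H : ℕ) (hv : v < N)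
    (hc : cur v < N) :
    remaining N d (Function.update cur v (cur v + 1)) v H < remaining N d cur v H := by
  unfold remaining
  refine Nat.add_lt_add_right (Nat.add_lt_add_right (Finset.sum_lt_sum (fun u _ => ?_)
    ⟨v, Finset.mem_range.2 hv, ?_⟩) _) _
  · rcases eq_or_ne u v with rfl | h
    · rw [Function.update_self]; omega
    · rw [Function.update_of_ne h]
  · rw [Function.update_self]; omega

/-- The weights are chosen for this case: of the `2 (N + 1)` released by one unit of label, `N` pays
for resetting the pointer and `N + 1` for the larger `H`, which leaves one. -/
theorem remaining_relabel {N v : ℕ} {d cur : ℕ → ℕ} (H : ℕ) (hv : v < N) (hd : d v < N)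
    (hc : cur v = N) :
    remaining N (Function.update d v (d v + 1)) (Function.update cur v 0) v (H + 1) <
      remaining N d cur v H := by
  have key : ∑ u ∈ Finset.range N, (2 * ((N + 1) * (N - Function.update d v (d v + 1) u)) +
      (N - Function.update cur v 0 u)) + (N + 2) =
      ∑ u ∈ Finset.range N, (2 * ((N + 1) * (N - d u)) + (N - cur u)) := by
    rw [← Finset.add_sum_erase _ _ (Finset.mem_range.2 hv),
      ← Finset.add_sum_erase _ _ (Finset.mem_range.2 hv),
      Finset.sum_congr rfl fun u (hu : u ∈ (Finset.range N).erase v) => by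
        rw [Function.update_of_ne (Finset.ne_of_mem_erase hu),
          Function.update_of_ne (Finset.ne_of_mem_erase hu)]]
    obtain ⟨x, hx⟩ := Nat.exists_eq_add_of_lt hd
    have h₁ : N - d v = x + 1 := by omega
    have h₂ : N - (d v + 1) = x := by omega
    rw [Function.update_self, Function.update_self, h₁, h₂, hc, Nat.mul_succ]
    omega
  unfold remaining
  rw [Nat.mul_succ]
  omega

theorem remaining_zero_le (N : ℕ) : remaining N 0 0 0 0 ≤ 6 * N ^ 3 + N := by
  simp only [remaining, Pi.zero_apply, Finset.sum_const, Finset.card_range, smul_eq_mul]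
  rcases N.eq_zero_or_pos with rfl | h
  · simp
  · have : N * N ≤ N * N * N := Nat.le_mul_of_pos_right _ h
    simp only [Nat.sub_zero, Nat.mul_zero, Nat.add_zero]
    nlinarith

/-! ## NCond and residual graphs -/

/-- By `symm` the net flow `r₀ - r` is antisymmetric, so the flow inside `X` cancels and only the
flow across its boundary remains. -/
theorem sum_excess_eq {V : Type*} [Fintype V] [DecidableEq V] {b e : V → ℝ} {r₀ r : V → V → ℝ}
    (symm : ∀ v w, r v w + r w v = r₀ v w + r₀ w v)
    (excess : ∀ v, e v = b v - ∑ w, (r₀ v w - r v w)) (X : Finset V) :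
    ∑ x ∈ X, e x = ∑ x ∈ X, b x - ∑ x ∈ X, ∑ y ∈ Xᶜ, (r₀ x y - r x y) := by
  have h : ∑ x ∈ X, ∑ y ∈ X, (r₀ x y - r x y) = 0 := by
    have h₁ : ∑ x ∈ X, ∑ y ∈ X, (r₀ x y - r x y) = -∑ x ∈ X, ∑ y ∈ X, (r₀ x y - r x y) := by
      conv_lhs => rw [Finset.sum_comm]
      rw [← Finset.sum_neg_distrib]
      refine Finset.sum_congr rfl fun x _ => ?_
      rw [← Finset.sum_neg_distrib]
      exact Finset.sum_congr rfl fun y _ => by linarith [symm x y]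
    linarith
  have h₂ : ∑ x ∈ X, e x = ∑ x ∈ X, (b x - (∑ y ∈ X, (r₀ x y - r x y) +
      ∑ y ∈ Xᶜ, (r₀ x y - r x y))) :=
    Finset.sum_congr rfl fun x _ => by rw [excess x, Finset.sum_add_sum_compl]
  rw [h₂, Finset.sum_sub_distrib, Finset.sum_add_distrib, h, zero_add]

section NCond

variable {C S : Type*} {E : Set (C × S)}

theorem exists_customer_of_connected (hE : (bipartiteGraph E).Connected) [Nonempty C] (s : S) :
    ∃ c, (c, s) ∈ E := by
  obtain ⟨c₀⟩ := ‹Nonempty C›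
  have : Nontrivial (C ⊕ S) := ⟨Sum.inl c₀, Sum.inr s, by simp⟩
  obtain ⟨x, hx⟩ := hE.preconnected.exists_adj_of_nontrivial (Sum.inr s)
  simp only [bipartiteGraph, SimpleGraph.fromRel_adj] at hx
  rcases hx.2 with ⟨c, t, h, -, -⟩ | ⟨c, t, -, h, h'⟩
  · simp at h
  · rw [Sum.inr.inj h]
    exact ⟨c, h'⟩

/-- Customer types supply `p`, server types demand `q`. -/
def supply (p : C → ℝ) (q : S → ℝ) : C ⊕ S → ℝ := Sum.elim p fun s => -q s

open Classical in
/-- The capacity `2` of the edges exceeds the total supply of a probability measure. -/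
noncomputable def capacity (E : Set (C × S)) : C ⊕ S → C ⊕ S → ℝ
  | .inl c, .inr s => if (c, s) ∈ E then 2 else 0
  | _, _ => 0

theorem capacity_nonneg (x y : C ⊕ S) : 0 ≤ capacity E x y := by
  rcases x with x | x <;> rcases y with y | y <;> simp only [capacity, le_refl]
  split_ifs <;> norm_num

theorem sum_supply (p : C → ℝ) (q : S → ℝ) (X : Finset (C ⊕ S)) :
    ∑ x ∈ X, supply p q x = ∑ c ∈ X.toLeft, p c - ∑ s ∈ X.toRight, q s := by
  conv_lhs => rw [← Finset.toLeft_disjSum_toRight (u := X), Finset.sum_disjSum]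
  simp [supply, sub_eq_add_neg]

variable [Fintype C] [Fintype S] {p : C → ℝ} {q : S → ℝ}

theorem pos_of_support {α : Type*} [Fintype α] {f : α → ℝ} (hf : f ∈ stdSimplex ℝ α)
    (hf' : Function.support f = Set.univ) (a : α) : 0 < f a :=
  lt_of_le_of_ne (hf.1 a) (Ne.symm (Function.mem_support.1 (hf' ▸ Set.mem_univ a)))

theorem nonempty_of_mem_stdSimplex {α : Type*} [Fintype α] {f : α → ℝ}
    (hf : f ∈ stdSimplex ℝ α) : Nonempty α := by
  by_contra h
  rw [not_nonempty_iff] at h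
  simpa using hf.2

/-- The inequalities for sets of customer types imply those for sets of server types. -/
theorem NCond.of_customers (hE : (bipartiteGraph E).Connected) (hp : p ∈ stdSimplex ℝ C)
    (hq : q ∈ stdSimplex ℝ S) (hq' : Function.support q = Set.univ)
    (h : ∀ U : Finset C, U.Nonempty → U ≠ Finset.univ →
      ∑ c ∈ U, p c < ∑ s ∈ serversOf E U, q s) : NCond E p q := by
  classical
  have := nonempty_of_mem_stdSimplex hp
  refine ⟨h, fun V hV hV' => ?_⟩
  have hqV := Finset.sum_add_sum_compl V q
  have hpV := Finset.sum_add_sum_compl (customersOf E V) p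
  rw [hq.2] at hqV
  rw [hp.2] at hpV
  -- The inequality for `V` follows from the one for the complement of `C(V)`, whose servers all
  -- avoid `V`, by passing to complements. If that complement is empty, the full support of `q`
  -- gives `q(V) < 1` directly.
  rcases (customersOf E V)ᶜ.eq_empty_or_nonempty with hU | hU
  · obtain ⟨s, hs⟩ : Vᶜ.Nonempty := by
      rwa [Finset.nonempty_iff_ne_empty, Ne, Finset.compl_eq_empty_iff]
    have : 0 < ∑ s ∈ Vᶜ, q s := Finset.sum_pos (fun s _ => pos_of_support hq hq' s) ⟨s, hs⟩
    rw [hU, Finset.sum_empty] at hpV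
    linarith
  · have h₁ : (customersOf E V)ᶜ ≠ Finset.univ := by
      obtain ⟨s, hs⟩ := hV
      obtain ⟨c, hc⟩ := exists_customer_of_connected hE s
      intro hcon
      have := Finset.mem_univ c
      rw [← hcon, Finset.mem_compl] at this
      exact this (Finset.mem_filter.2 ⟨Finset.mem_univ c, s, hs, hc⟩)
    have h₂ : serversOf E (customersOf E V)ᶜ ⊆ Vᶜ := by
      intro s hs
      obtain ⟨-, c, hc, hcs⟩ := Finset.mem_filter.1 hs
      rw [Finset.mem_compl] at hc ⊢
      exact fun hsV => hc (Finset.mem_filter.2 ⟨Finset.mem_univ c, s, hsV, hcs⟩)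
    have h₃ := h _ hU h₁
    have h₄ := Finset.sum_le_sum_of_subset_of_nonneg h₂ fun s _ _ => hq.1 s
    linarith

variable {e : C ⊕ S → ℝ} {r : C ⊕ S → C ⊕ S → ℝ}

/-- A set that is closed in the residual graph and has no deficit contradicts NCond, unless it is
trivial. -/
theorem not_nCond_of_closed (hE : (bipartiteGraph E).Connected) (hp : p ∈ stdSimplex ℝ C)
    (hq : q ∈ stdSimplex ℝ S) (hq' : Function.support q = Set.univ)
    (symm : ∀ v w, r v w + r w v = capacity E v w + capacity E w v)
    (excess : ∀ v, e v = supply p q v - ∑ w, (capacity E v w - r v w))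
    {X : Finset (C ⊕ S)} (hX : ∀ x ∈ X, ∀ y ∉ X, r x y = 0) (he : ∀ x ∈ X, 0 ≤ e x)
    (h : (∃ x ∈ X, 0 < e x) ∨ X.Nonempty ∧ X ≠ Finset.univ) : ¬ NCond E p q := by
  classical
  intro hN
  have := nonempty_of_mem_stdSimplex hp
  have hcut := sum_excess_eq symm excess X
  have hr : ∑ x ∈ X, ∑ y ∈ Xᶜ, (capacity E x y - r x y) = ∑ x ∈ X, ∑ y ∈ Xᶜ, capacity E x y :=
    Finset.sum_congr rfl fun x hx => Finset.sum_congr rfl fun y hy => by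
      rw [hX x hx y (Finset.mem_compl.1 hy), sub_zero]
  rw [hr, sum_supply] at hcut
  have he₀ := Finset.sum_nonneg he
  have hcap : 0 ≤ ∑ x ∈ X, ∑ y ∈ Xᶜ, capacity E x y :=
    Finset.sum_nonneg fun x _ => Finset.sum_nonneg fun y _ => capacity_nonneg x y
  have hW : 0 ≤ ∑ s ∈ X.toRight, q s := Finset.sum_nonneg fun s _ => hq.1 s
  have hU : ∑ c ∈ X.toLeft, p c ≤ 1 := by
    rw [← hp.2]
    exact Finset.sum_le_univ_sum_of_nonneg hp.1
  -- An edge leaving `X` would contribute capacity 2 to `hcut`, while the supply of `X` is at most 1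
  -- and its excess is nonnegative.
  have hsub : serversOf E X.toLeft ⊆ X.toRight := by
    intro s hs
    obtain ⟨-, c, hc, hcs⟩ := Finset.mem_filter.1 hs
    by_contra hsX
    rw [Finset.mem_toRight] at hsX
    rw [Finset.mem_toLeft] at hc
    have h₁ : capacity E (Sum.inl c) (Sum.inr s) ≤ ∑ y ∈ Xᶜ, capacity E (Sum.inl c) y :=
      Finset.single_le_sum (fun y _ => capacity_nonneg _ y) (Finset.mem_compl.2 hsX)
    have h₂ : ∑ y ∈ Xᶜ, capacity E (Sum.inl c) y ≤ ∑ x ∈ X, ∑ y ∈ Xᶜ, capacity E x y :=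
      Finset.single_le_sum (f := fun x => ∑ y ∈ Xᶜ, capacity E x y)
        (fun x _ => Finset.sum_nonneg fun y _ => capacity_nonneg x y) hc
    have h₃ : capacity E (Sum.inl c) (Sum.inr s) = 2 := by simp only [capacity, hcs, if_true]
    linarith
  have hle := Finset.sum_le_sum_of_subset_of_nonneg hsub fun s _ _ => hq.1 s
  have hpos : (∃ x ∈ X, 0 < e x) → 0 < ∑ x ∈ X, e x := fun ⟨x, hx, hx'⟩ =>
    Finset.sum_pos' he ⟨x, hx, hx'⟩
  -- If `X` has no customers, `hcut` forces its excess and its demand to vanish; if it has all of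
  -- them, it is everything and its supply is zero. Otherwise NCond makes its supply, and hence its
  -- excess, negative.
  rcases X.toLeft.eq_empty_or_nonempty with hU₀ | hU₀
  · rw [hU₀, Finset.sum_empty] at hcut
    rcases h with h | h
    · linarith [hpos h]
    · obtain ⟨x, hx⟩ := h.1
      rcases x with c | s
      · rw [← Finset.mem_toLeft, hU₀] at hx
        simp at hx
      · have : 0 < ∑ s ∈ X.toRight, q s :=
          Finset.sum_pos (fun s _ => pos_of_support hq hq' s) ⟨s, Finset.mem_toRight.2 hx⟩
        linarith
  · by_cases hU₁ : X.toLeft = Finset.univ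
    · have hW₁ : X.toRight = Finset.univ := by
        refine Finset.eq_univ_of_forall fun s => hsub ?_
        obtain ⟨c, hc⟩ := exists_customer_of_connected hE s
        exact Finset.mem_filter.2 ⟨Finset.mem_univ s, c, hU₁ ▸ Finset.mem_univ c, hc⟩
      rw [hU₁, hW₁, hp.2, hq.2] at hcut
      rcases h with h | h
      · linarith [hpos h]
      · refine h.2 (Finset.eq_univ_of_forall fun x => ?_)
        rcases x with c | s
        · exact Finset.mem_toLeft.1 (hU₁ ▸ Finset.mem_univ c)
        · exact Finset.mem_toRight.1 (hW₁ ▸ Finset.mem_univ s)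
    · linarith [hN.1 _ hU₀ hU₁]

/-- Supply and demand both have total 1, so the excesses sum to zero; nonpositive terms with sum
zero vanish. -/
theorem excess_eq_zero (hp : p ∈ stdSimplex ℝ C) (hq : q ∈ stdSimplex ℝ S)
    (symm : ∀ v w, r v w + r w v = capacity E v w + capacity E w v)
    (excess : ∀ v, e v = supply p q v - ∑ w, (capacity E v w - r v w))
    (he : ∀ x, e x ≤ 0) (x : C ⊕ S) : e x = 0 := by
  classical
  have h₁ := sum_excess_eq symm excess Finset.univ
  rw [sum_supply] at h₁
  simp only [Finset.toLeft_univ, Finset.toRight_univ, hp.2, hq.2, Finset.compl_univ,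
    Finset.sum_empty, Finset.sum_const_zero, sub_self] at h₁
  exact (Finset.sum_eq_zero_iff_of_nonpos fun x _ => he x).1 h₁ x (Finset.mem_univ x)

/-- If no vertex has a positive excess and the residual graph is strongly connected, then NCond
holds. -/
theorem nCond_of_strongly_connected (hE : (bipartiteGraph E).Connected)
    (hp : p ∈ stdSimplex ℝ C) (hq : q ∈ stdSimplex ℝ S) (hq' : Function.support q = Set.univ)
    (symm : ∀ v w, r v w + r w v = capacity E v w + capacity E w v)
    (excess : ∀ v, e v = supply p q v - ∑ w, (capacity E v w - r v w))
    (hr : ∀ x y, 0 ≤ r x y) (he : ∀ x, e x ≤ 0)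
    (h : ∀ X : Finset (C ⊕ S), (∀ x ∈ X, ∀ y ∉ X, r x y = 0) → X.Nonempty → X = Finset.univ) :
    NCond E p q := by
  classical
  have he₀ := excess_eq_zero hp hq symm excess he
  refine .of_customers hE hp hq hq' fun U hU hU' => ?_
  -- No arc of positive capacity leaves this set, so the cut identity makes the residual capacity
  -- out of it equal to `q(S(U)) - p(U)`.
  set X : Finset (C ⊕ S) := U.disjSum (serversOf E U) with hX
  have hcut := sum_excess_eq symm excess X
  rw [sum_supply] at hcut
  simp only [he₀, Finset.sum_const_zero, hX, Finset.toLeft_disjSum,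
    Finset.toRight_disjSum] at hcut
  rw [← hX] at hcut
  have hcap : ∑ x ∈ X, ∑ y ∈ Xᶜ, (capacity E x y - r x y) = -∑ x ∈ X, ∑ y ∈ Xᶜ, r x y := by
    rw [← Finset.sum_neg_distrib]
    refine Finset.sum_congr rfl fun x hx => ?_
    rw [← Finset.sum_neg_distrib]
    refine Finset.sum_congr rfl fun y hy => ?_
    suffices capacity E x y = 0 by rw [this, zero_sub]
    rcases x with c | s <;> rcases y with c' | s' <;> simp only [capacity]
    rw [if_neg]
    intro hcs
    rw [Finset.mem_compl, hX, Finset.inr_mem_disjSum] at hy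
    rw [hX, Finset.inl_mem_disjSum] at hx
    exact hy (Finset.mem_filter.2 ⟨Finset.mem_univ _, c, hx, hcs⟩)
  -- If no residual capacity left `X`, then `X` would be closed and hence everything, although `U`
  -- is a proper subset.
  have hpos : 0 < ∑ x ∈ X, ∑ y ∈ Xᶜ, r x y := by
    by_contra hcon
    have h₀ := le_antisymm (not_lt.1 hcon)
      (Finset.sum_nonneg fun x _ => Finset.sum_nonneg fun y _ => hr x y)
    rw [Finset.sum_eq_zero_iff_of_nonneg fun x _ => Finset.sum_nonneg fun y _ => hr x y] at h₀
    have hXu := h X (fun x hx y hy =>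
      (Finset.sum_eq_zero_iff_of_nonneg fun y _ => hr x y).1 (h₀ x hx) y (Finset.mem_compl.2 hy))
      (by obtain ⟨c, hc⟩ := hU; exact ⟨Sum.inl c, by simpa [hX] using hc⟩)
    refine hU' (Finset.eq_univ_of_forall fun c => ?_)
    have : Sum.inl c ∈ X := hXu ▸ Finset.mem_univ _
    simpa [hX] using this
  linarith

end NCond

namespace RealRAM

/-! ## The push-relabel program

Variables: `2` the number `N` of vertices, `3` the vertex `v` under treatment, `4` the head `w` of
its current arc, `6` the flag of the sweep, `7` whether the program is running, `8` the outcome.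
Integer arrays: `1` the offsets `v * N`, `2` the labels, `3` the current arcs. Real arrays: `3` the
excesses, `4` the residual capacities, `5` the amount of a push. -/

namespace PushRelabel

/-- The number of vertices. -/
def size : IExp := .var 2

/-- The vertex under treatment. -/
def vertex : IExp := .var 3

/-- The head of the current arc. -/
def head : IExp := .var 4

/-- The label of `v`. -/
def label (v : IExp) : IExp := .get 2 v

/-- The excess of `v`. -/
def excess (v : IExp) : RExp := .get 3 v

/-- The cell of the residual capacity of the arc from `v` to `w`. -/
def arc (v w : IExp) : IExp := .add (.get 1 v) w

/-- The residual capacity of the arc from `v` to `w`. -/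
def residual (v w : IExp) : RExp := .get 4 (arc v w)

/-- Halt with outcome `k`. -/
def halt (k : ℕ) : Program := .seq (.setVar 7 (.lit 0)) (.setVar 8 (.lit k))

/-- Begin a new sweep, unless nothing happened in the last one. -/
def nextSweep : Program :=
  .branch (.ile (.var 6) (.lit 0)) (halt 1) (.seq (.setVar 3 (.lit 0)) (.setVar 6 (.lit 0)))

/-- Go on to the next vertex. -/
def nextVertex : Program := .setVar 3 (.add vertex (.lit 1))

/-- Go on to the next arc. -/
def nextArc : Program := .setInt 3 vertex (.add (.get 3 vertex) (.lit 1))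

/-- Increase the label of the vertex under treatment. -/
def relabel : Program :=
  .seq (.setInt 2 vertex (.add (label vertex) (.lit 1))) <|
  .seq (.setInt 3 vertex (.lit 0)) <|
  .branch (.ile size (label vertex)) (halt 0) .skip

/-- Push the amount `δ` along the current arc. -/
def push (δ : RExp) : Program :=
  .seq (.setReal 5 (.lit 0) δ) <|
  .seq (.setReal 4 (arc vertex head) (.sub (residual vertex head) (.get 5 (.lit 0)))) <|
  .seq (.setReal 4 (arc head vertex) (.add (residual head vertex) (.get 5 (.lit 0)))) <|
  .seq (.setReal 3 vertex (.sub (excess vertex) (.get 5 (.lit 0)))) <|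
  .seq (.setReal 3 head (.add (excess head) (.get 5 (.lit 0))))
    (.setVar 6 (.lit 1))

/-- Whether the current arc is admissible. -/
def admissible : Test :=
  .conj (.ile (label vertex) (.add (label head) (.lit 1))) <|
  .conj (.ile (.add (label head) (.lit 1)) (label vertex)) (.neg (.rle (residual vertex head) .zero))

/-- Treat the current arc. -/
def treatArc : Program :=
  .seq (.setVar 4 (.get 3 vertex)) <|
  .branch admissible
    (.branch (.rle (excess vertex) (residual vertex head))
      (.seq (push (excess vertex)) nextVertex)
      (.seq (push (residual vertex head)) nextArc))
    nextArc

/-- One round of the push-relabel program. -/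
def round : Program :=
  .branch (.ile size vertex) nextSweep <|
  .branch (.rle (excess vertex) .zero) nextVertex <|
  .branch (.ile size (.get 3 vertex)) relabel treatArc

/-- The push-relabel program. -/
def main : Program := .loop (.ile (.lit 1) (.var 7)) round

theorem round_loopFree : round.LoopFree := by
  simp [round, nextSweep, nextVertex, nextArc, relabel, treatArc, push, halt, Program.LoopFree]

/-- The residual capacities stored in the memory. -/
def res (N : ℕ) (σ : State) (v w : ℕ) : ℝ := σ.reals 4 (v * N + w)

@[simp] theorem res_putVar (N : ℕ) (σ : State) (x v : ℕ) : res N (σ.putVar x v) = res N σ := rfl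
@[simp] theorem res_putInt (N : ℕ) (σ : State) (a i v : ℕ) : res N (σ.putInt a i v) = res N σ := rfl

/-- Row-major addressing is division with remainder by `N`; distinct arcs therefore never share a
cell. -/
theorem cell_inj {N v w x y : ℕ} (hw : w < N) (hy : y < N) (h : v * N + w = x * N + y) :
    v = x ∧ w = y := by
  have h₁ : v = x := by
    have h₂ := congrArg (· / N) h
    have hN : 0 < N := by omega
    simpa [Nat.add_comm _ w, Nat.add_comm _ y, Nat.add_mul_div_right _ _ hN,
      Nat.div_eq_of_lt hw, Nat.div_eq_of_lt hy] using h₂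
  subst h₁
  exact ⟨rfl, by omega⟩

variable {N : ℕ} {b : ℕ → ℝ} {r₀ : ℕ → ℕ → ℝ} {k : ℕ} {σ : State}

/-- The parts of the memory that describe the network, and the marks that are still to be set. -/
structure Network (N : ℕ) (b : ℕ → ℝ) (r₀ : ℕ → ℕ → ℝ) (σ : State) : Prop where
  size : σ.vars 2 = N
  offset : ∀ v < N, σ.ints 1 v = v * N
  labelled : Labelled N b r₀ (σ.reals 3) (res N σ) (σ.ints 2) (σ.ints 3)
  marks : σ.ints 4 = 0 ∧ σ.ints 5 = 0

/-- The invariant while the program is running. -/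
structure Running (N : ℕ) (b : ℕ → ℝ) (r₀ : ℕ → ℕ → ℝ) (k : ℕ) (σ : State) : Prop
    extends Network N b r₀ σ where
  lt : ∀ v < N, σ.ints 2 v < N
  le : σ.vars 3 ≤ N
  running : σ.vars 7 = 1
  sweep : ∃ H, Sweep N (σ.reals 3) (σ.ints 2) (σ.vars 3) (σ.vars 6) H ∧
    k = remaining N (σ.ints 2) (σ.ints 3) (σ.vars 3) H + 1

/-- The final memory: either no vertex is active, or an active vertex has a label `N`. -/
structure Finished (N : ℕ) (b : ℕ → ℝ) (r₀ : ℕ → ℕ → ℝ) (σ : State) : Prop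
    extends Network N b r₀ σ where
  stopped : σ.vars 7 = 0
  outcome : (σ.vars 8 = 1 ∧ ∀ v < N, σ.reals 3 v ≤ 0) ∨
    (σ.vars 8 = 0 ∧ ∃ v < N, 0 < σ.reals 3 v ∧ N ≤ σ.ints 2 v)

/-- The loop invariant. -/
def Inv (N : ℕ) (b : ℕ → ℝ) (r₀ : ℕ → ℕ → ℝ) (k : ℕ) (σ : State) : Prop :=
  Running N b r₀ k σ ∨ Finished N b r₀ σ

/-! ### Each round preserves the invariant and lowers the measure -/

theorem nextSweep_step (h : Running N b r₀ k σ) (hv : N ≤ σ.vars 3) :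
    ∃ k' < k, Inv N b r₀ k' (nextSweep.run σ) := by
  obtain ⟨H, hS, rfl⟩ := h.sweep
  by_cases ha : σ.vars 6 = 0
  -- A running state has measure `remaining + 1 > 0`, so the finished state can be given measure
  -- `0`.
  · refine ⟨0, Nat.succ_pos _, .inr ?_⟩
    simp only [nextSweep, Program.run, Test.Holds, IExp.eval, ha, le_refl, if_true, halt]
    exact ⟨⟨by simpa using h.size, h.offset, h.labelled, h.marks⟩, by simp, .inl
      ⟨by simp, fun v hv' => hS.idle ha v hv' (by omega)⟩⟩
  -- A push has occurred in this sweep, so `H` is positive and can be lowered.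
  · obtain ⟨H, rfl⟩ := Nat.exists_eq_succ_of_ne_zero (hS.busy ha).ne'
    refine ⟨_, Nat.succ_lt_succ (remaining_restart _ _ H hv), .inl ?_⟩
    simp only [nextSweep, Program.run, Test.Holds, IExp.eval, Nat.le_zero, ha, if_false]
    exact ⟨⟨by simpa using h.size, h.offset, h.labelled, h.marks⟩, h.lt, by simp,
      by simpa using h.running, H, by simpa using hS.restart hv, by simp⟩

theorem nextVertex_step (h : Running N b r₀ k σ) (hv : σ.vars 3 < N)
    (he : σ.reals 3 (σ.vars 3) ≤ 0) : ∃ k' < k, Inv N b r₀ k' (nextVertex.run σ) := by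
  obtain ⟨H, hS, rfl⟩ := h.sweep
  refine ⟨_, Nat.succ_lt_succ (remaining_next _ _ H hv), .inl ?_⟩
  simp only [nextVertex, Program.run, IExp.eval, vertex]
  exact ⟨⟨by simpa using h.size, h.offset, h.labelled, h.marks⟩, h.lt, by simpa using hv,
    by simpa using h.running, H, by simpa using hS.next he, by simp⟩

theorem nextArc_step (h : Running N b r₀ k σ) (hv : σ.vars 3 < N)
    (hc : σ.ints 3 (σ.vars 3) < N)
    (ha : 0 < res N σ (σ.vars 3) (σ.ints 3 (σ.vars 3)) →
      σ.ints 2 (σ.vars 3) ≤ σ.ints 2 (σ.ints 3 (σ.vars 3))) :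
    ∃ k' < k, Inv N b r₀ k' (nextArc.run σ) := by
  obtain ⟨H, hS, rfl⟩ := h.sweep
  refine ⟨_, Nat.succ_lt_succ (remaining_advance _ H hv hc), .inl ?_⟩
  simp only [nextArc, Program.run, IExp.eval, vertex]
  exact ⟨⟨by simpa using h.size, by simpa using h.offset,
    by simpa using h.labelled.advance hc ha, by simpa using h.marks⟩,
    by simpa using h.lt, h.le, by simpa using h.running, H, by simpa using hS, by simp⟩

theorem relabel_step (h : Running N b r₀ k σ) (hv : σ.vars 3 < N)
    (he : 0 < σ.reals 3 (σ.vars 3)) (hc : N ≤ σ.ints 3 (σ.vars 3)) :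
    ∃ k' < k, Inv N b r₀ k' (relabel.run σ) := by
  obtain ⟨H, hS, rfl⟩ := h.sweep
  have hc' : σ.ints 3 (σ.vars 3) = N := le_antisymm (h.labelled.cur_le _ hv) hc
  have hl := h.labelled.relabel hv he hc'
  by_cases hN : N ≤ σ.ints 2 (σ.vars 3) + 1
  · have hrun : relabel.run σ = (((σ.putInt 2 (σ.vars 3) (σ.ints 2 (σ.vars 3) + 1)).putInt 3
        (σ.vars 3) 0).putVar 7 0).putVar 8 0 := by
      simp [relabel, Program.run, Test.Holds, IExp.eval, vertex, label, size, halt, h.size, hN]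
    rw [hrun]
    refine ⟨0, Nat.succ_pos _, .inr ?_⟩
    exact ⟨⟨by simpa using h.size, by simpa using h.offset, by simpa using hl,
      by simpa using h.marks⟩, by simp, .inr ⟨by simp, σ.vars 3, hv, by simpa using he,
      by simpa using hN⟩⟩
  · have hrun : relabel.run σ = (σ.putInt 2 (σ.vars 3) (σ.ints 2 (σ.vars 3) + 1)).putInt 3
        (σ.vars 3) 0 := by
      simp [relabel, Program.run, Test.Holds, IExp.eval, vertex, label, size, h.size, hN]
    rw [hrun]
    refine ⟨_, Nat.succ_lt_succ (remaining_relabel H hv (h.lt _ hv) hc'), .inl ?_⟩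
    refine ⟨⟨by simpa using h.size, by simpa using h.offset, by simpa using hl,
      by simpa using h.marks⟩, fun u hu => ?_, h.le, h.running, H + 1,
      by simpa using hS.relabel hv he, by simp⟩
    have := h.lt u hu
    rcases eq_or_ne u (σ.vars 3) with rfl | huv
    · simpa using hN
    · simpa [huv] using this

/-- What a push does to the memory. -/
theorem push_step (h : Running N b r₀ k σ) (hv : σ.vars 3 < N) (hw : σ.vars 4 < N)
    (he : 0 < σ.reals 3 (σ.vars 3)) (hd : σ.ints 2 (σ.vars 3) = σ.ints 2 (σ.vars 4) + 1)
    (δ : RExp) (hδ : 0 ≤ δ.eval σ) (hδe : δ.eval σ ≤ σ.reals 3 (σ.vars 3))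
    (hδr : δ.eval σ ≤ res N σ (σ.vars 3) (σ.vars 4)) :
    Running N b r₀ k ((push δ).run σ) ∧ ((push δ).run σ).vars 3 = σ.vars 3 ∧
      ((push δ).run σ).ints = σ.ints ∧
      ((push δ).run σ).reals 3 (σ.vars 3) = σ.reals 3 (σ.vars 3) - δ.eval σ ∧
      res N ((push δ).run σ) (σ.vars 3) (σ.vars 4) =
        res N σ (σ.vars 3) (σ.vars 4) - δ.eval σ := by
  obtain ⟨H, hS, rfl⟩ := h.sweep
  set v := σ.vars 3 with hvdef
  set w := σ.vars 4 with hwdef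
  have hvw : v ≠ w := by rintro hvw; rw [hvw] at hd; omega
  -- The arc and its reverse occupy different cells. The amount was first copied to real array `5`,
  -- since `δ` may refer to the quantities that are overwritten.
  have h₁ : w * N + v ≠ v * N + w := fun hcon => hvw.symm (cell_inj hv hw hcon).1
  have hvars : ∀ x, ((push δ).run σ).vars x = if x = 6 then 1 else σ.vars x := by
    simp [push, Program.run, IExp.eval]
  have hints : ((push δ).run σ).ints = σ.ints := by simp [push, Program.run]
  have hreals : ((push δ).run σ).reals 3 = Function.update (Function.update (σ.reals 3) v
      (σ.reals 3 v - δ.eval σ)) w (σ.reals 3 w + δ.eval σ) := by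
    simp [push, Program.run, IExp.eval, RExp.eval, arc, residual, excess, vertex, head,
      ← hvdef, ← hwdef, hvw.symm]
  have hres : ((push δ).run σ).reals 4 = Function.update (Function.update (σ.reals 4) (v * N + w)
      (σ.reals 4 (v * N + w) - δ.eval σ)) (w * N + v) (σ.reals 4 (w * N + v) + δ.eval σ) := by
    simp [push, Program.run, IExp.eval, RExp.eval, arc, residual, excess, vertex, head,
      ← hvdef, ← hwdef, h.offset v hv, h.offset w hw, h₁]
  have hev : ((push δ).run σ).reals 3 v = σ.reals 3 v - δ.eval σ := by simp [hreals, hvw]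
  have hu : ∀ u, u ≠ v → u ≠ w → ((push δ).run σ).reals 3 u = σ.reals 3 u := by
    intro u h₁ h₂
    simp [hreals, h₁, h₂]
  have hrv : res N ((push δ).run σ) v w = res N σ v w - δ.eval σ := by
    simp [res, hres, h₁.symm]
  refine ⟨⟨⟨by simpa [hvars] using h.size, by simpa [hints] using h.offset, ?_,
    by simpa [hints] using h.marks⟩, by simpa [hints] using h.lt, by simpa [hvars] using h.le,
    by simpa [hvars] using h.running, H, ?_, by simp [hints, hvars, hvdef]⟩,
    by simp [hvars, hvdef], hints, hev, hrv⟩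
  · rw [hints]
    refine h.labelled.push hv hw hd hδ hδe hδr hev (by simp [hreals]) hu hrv
      (by simp [res, hres]) fun x hx y hy hxy hxy' => ?_
    have h₂ : x * N + y ≠ v * N + w := fun hcon => hxy (cell_inj hy hw hcon)
    have h₃ : x * N + y ≠ w * N + v := fun hcon => hxy' (cell_inj hy hv hcon)
    simp [res, hres, h₂, h₃]
  · have := hS.push (w := w) hv he hd (hev.trans_le (by linarith)) hu
    simpa [hints, hvars] using this

/-- A push empties the vertex or the arc. In the first case the visit of the vertex ends; in the
second the pointer may pass the arc, which has no residual capacity left. Pushes thus need no charge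
of their own. A residual arc that is not admissible satisfies `d v ≤ d w` by validity, so it may be
passed too. -/
theorem treatArc_step (h : Running N b r₀ k σ) (hv : σ.vars 3 < N)
    (he : 0 < σ.reals 3 (σ.vars 3)) (hc : σ.ints 3 (σ.vars 3) < N) :
    ∃ k' < k, Inv N b r₀ k' (treatArc.run σ) := by
  set τ := σ.putVar 4 (σ.ints 3 (σ.vars 3)) with hτ
  have hτ3 : τ.vars 3 = σ.vars 3 := by simp [hτ]
  have hτ4 : τ.vars 4 = σ.ints 3 (σ.vars 3) := by simp [hτ]
  have hτi : τ.ints = σ.ints := rfl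
  have hτr : τ.reals = σ.reals := rfl
  have h' : Running N b r₀ k τ := by
    obtain ⟨H, hS, hk⟩ := h.sweep
    exact ⟨⟨by simpa [hτ] using h.size, h.offset, h.labelled, h.marks⟩, h.lt,
      by simpa [hτ] using h.le, by simpa [hτ] using h.running, H, by simpa [hτ] using hS,
      by simpa [hτ] using hk⟩
  have hrun : treatArc.run σ = (Program.branch admissible
    (.branch (.rle (excess vertex) (residual vertex head))
      (.seq (push (excess vertex)) nextVertex)
      (.seq (push (residual vertex head)) nextArc))
    nextArc).run τ := rfl
  rw [hrun]
  clear hrun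
  clear_value τ
  have hr : (residual vertex head).eval τ = res N τ (τ.vars 3) (τ.vars 4) := by
    simp [residual, arc, vertex, head, RExp.eval, IExp.eval, res, h'.offset _ (hτ3 ▸ hv)]
  have hx : (excess vertex).eval τ = τ.reals 3 (τ.vars 3) := rfl
  have hadm : admissible.Holds τ ↔ τ.ints 2 (τ.vars 3) = τ.ints 2 (τ.vars 4) + 1 ∧
      0 < res N τ (τ.vars 3) (τ.vars 4) := by
    simp only [admissible, Test.Holds, hr, not_le]
    rw [← and_assoc]
    exact and_congr_left' le_antisymm_iff.symm
  have hτ3' : τ.vars 3 < N := hτ3 ▸ hv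
  have hτ4' : τ.vars 4 < N := hτ4 ▸ hc
  have he' : 0 < τ.reals 3 (τ.vars 3) := by rwa [hτr, hτ3]
  have hcur : τ.ints 3 (τ.vars 3) = τ.vars 4 := by rw [hτ4, hτ3, hτi]
  simp only [Program.run]
  by_cases ha : admissible.Holds τ
  · rw [if_pos ha]
    obtain ⟨hd, hpos⟩ := hadm.1 ha
    simp only [Test.Holds, hx, hr]
    split_ifs with hle
    · obtain ⟨h₁, h₂, -, h₄, -⟩ := push_step h' hτ3' hτ4' he' hd (excess vertex) he'.le le_rfl hle
      refine nextVertex_step h₁ (h₂ ▸ hτ3') ?_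
      rw [h₂, h₄, hx, sub_self]
    · obtain ⟨h₁, h₂, h₃, -, h₅⟩ := push_step h' hτ3' hτ4' he' hd (residual vertex head)
        (hr ▸ hpos.le) (hr ▸ (not_le.1 hle).le) hr.le
      refine nextArc_step h₁ (h₂ ▸ hτ3') ?_ ?_
      · rwa [h₂, h₃, hcur]
      · rw [h₂, h₃, hcur, h₅, hr, sub_self]
        exact fun hcon => absurd hcon (lt_irrefl _)
  · rw [if_neg ha]
    refine nextArc_step h' hτ3' (hcur ▸ hτ4') ?_
    rw [hcur]
    intro hpos
    by_contra hlt
    have := h'.labelled.valid _ hτ3' _ hτ4' hpos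
    exact ha (hadm.2 ⟨by omega, hpos⟩)

theorem round_step (h : Running N b r₀ k σ) : ∃ k' < k, Inv N b r₀ k' (round.run σ) := by
  simp only [round, Program.run, Test.Holds, IExp.eval, RExp.eval, size, vertex, excess, h.size]
  split_ifs with h₁ h₂ h₃
  · exact nextSweep_step h h₁
  · exact nextVertex_step h (not_le.1 h₁) h₂
  · exact relabel_step h (not_le.1 h₁) (not_le.1 h₂) h₃
  · exact treatArc_step h (not_le.1 h₁) (not_le.1 h₂) (not_le.1 h₃)

/-- The constant `4` is the cost `3` of the loop test plus one step for the jump. -/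
theorem main_reaches (h : Running N b r₀ k σ) :
    main.Reaches σ ((k + 1) * (4 + round.time)) (Finished N b r₀) := by
  obtain ⟨t, τ, ht, hT, hτ, k', h' | h'⟩ := round_loopFree.loop_reaches
    (b := .ile (.lit 1) (.var 7)) (I := Inv N b r₀) (fun k σ h hb => by
      rcases h with h | h
      · exact round_step h
      · simp [Test.Holds, IExp.eval, h.stopped] at hb) (.inl h)
  · exact absurd (by simp [Test.Holds, IExp.eval, h'.running]) hτ
  · exact ⟨t, τ, ht, hT, h'⟩

end PushRelabel

end RealRAM

/-! ## Search in a graph -/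

/-- Every set of vertices that contains `0` and is closed under `ρ` contains all vertices. -/
def Spans (N : ℕ) (ρ : ℕ → ℕ → Prop) : Prop :=
  ∀ X : Set ℕ, 0 ∈ X → (∀ x < N, x ∈ X → ∀ y < N, ρ x y → y ∈ X) → ∀ u < N, u ∈ X

/-- The state of a search for the vertices that are reachable from `0` along the relation `ρ`:
`mk` marks the vertices that were found, `cnt` is their number, and the arcs before the arc
from `v` to `w` lead from marked vertices to marked ones only. -/
structure Marking (N : ℕ) (ρ : ℕ → ℕ → Prop) (mk : ℕ → ℕ) (cnt v w : ℕ) : Prop where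
  zero : mk 0 = 1
  le_one : ∀ u, mk u ≤ 1
  count : cnt = ∑ u ∈ Finset.range N, mk u
  least : ∀ X : Set ℕ, 0 ∈ X → (∀ x < N, x ∈ X → ∀ y < N, ρ x y → y ∈ X) →
    ∀ u < N, mk u = 1 → u ∈ X
  rows : ∀ x < N, x < v → mk x = 1 → ∀ y < N, ρ x y → mk y = 1
  row : mk v = 1 → ∀ y < N, y < w → ρ v y → mk y = 1

namespace Marking

variable {N : ℕ} {ρ : ℕ → ℕ → Prop} {mk : ℕ → ℕ} {cnt v w : ℕ}

theorem nextRow (h : Marking N ρ mk cnt v w) (hw : N ≤ w) : Marking N ρ mk cnt (v + 1) 0 where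
  zero := h.zero
  le_one := h.le_one
  count := h.count
  least := h.least
  rows x hx hxv hm y hy := by
    rcases (Nat.lt_succ_iff.1 hxv).eq_or_lt with rfl | hxv
    · exact h.row hm y hy (hy.trans_le hw)
    · exact h.rows x hx hxv hm y hy
  row _ y _ hy := by omega

theorem nextArc (h : Marking N ρ mk cnt v w) (hm : mk v = 1 → ρ v w → mk w = 1) :
    Marking N ρ mk cnt v (w + 1) where
  zero := h.zero
  le_one := h.le_one
  count := h.count
  least := h.least
  rows := h.rows
  row hv y hy hyw hρ := by
    rcases (Nat.lt_succ_iff.1 hyw).eq_or_lt with rfl | hyw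
    · exact hm hv hρ
    · exact h.row hv y hy hyw hρ

/-- Arcs out of `w` may have been scanned while `w` was unmarked, so the scan returns to the first
arc, where `rows` and `row` are vacuous. There are at most `N` such returns, each followed by
`O(N²)` rounds, which stays cubic without a queue. -/
theorem mark (h : Marking N ρ mk cnt v w) (hv : v < N) (hw : w < N) (hmv : mk v = 1)
    (hmw : mk w = 0) (hρ : ρ v w) : Marking N ρ (Function.update mk w 1) (cnt + 1) 0 0 where
  zero := by
    rcases eq_or_ne w 0 with rfl | hw₀
    · simp
    · simpa [hw₀.symm] using h.zero
  le_one u := by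
    rcases eq_or_ne u w with rfl | hu
    · simp
    · simpa [hu] using h.le_one u
  count := by
    have h₁ := Finset.add_sum_erase (Finset.range N) mk (Finset.mem_range.2 hw)
    have h₂ := Finset.add_sum_erase (Finset.range N) (Function.update mk w 1)
      (Finset.mem_range.2 hw)
    have h₃ : ∑ u ∈ (Finset.range N).erase w, Function.update mk w 1 u =
        ∑ u ∈ (Finset.range N).erase w, mk u :=
      Finset.sum_congr rfl fun u hu => Function.update_of_ne (Finset.ne_of_mem_erase hu) 1 mk
    rw [Function.update_self] at h₂
    have := h.count
    omega
  least X h₀ hX u hu hmu := by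
    rcases eq_or_ne u w with rfl | huw
    · exact hX v hv (h.least X h₀ hX v hv hmv) u hu hρ
    · exact h.least X h₀ hX u hu (by simpa [huw] using hmu)
  rows x _ hx := by omega
  row _ y _ hy := by omega

theorem count_le (h : Marking N ρ mk cnt v w) : cnt ≤ N := by
  rw [h.count]
  simpa using Finset.sum_le_card_nsmul (Finset.range N) mk 1 fun u _ => h.le_one u

/-- When the search is complete, it has found all vertices if and only if every closed set that
contains `0` contains all vertices. -/
theorem count_eq_iff (h : Marking N ρ mk cnt v w) (hv : N ≤ v) :
    cnt = N ↔ Spans N ρ := by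
  refine ⟨fun hc X h₀ hX u hu => h.least X h₀ hX u hu ?_, fun hX => ?_⟩
  · by_contra hm
    have h₁ : ∑ u ∈ Finset.range N, mk u < ∑ u ∈ Finset.range N, 1 :=
      Finset.sum_lt_sum (fun u _ => h.le_one u)
        ⟨u, Finset.mem_range.2 hu, lt_of_le_of_ne (h.le_one u) hm⟩
    simp only [Finset.sum_const, Finset.card_range, smul_eq_mul, mul_one, ← h.count] at h₁
    omega
  -- Once all rows are scanned, the marked set is closed itself, so `Spans` applies to it.
  · rw [h.count, Finset.sum_congr rfl fun u hu => hX {u | mk u = 1} h.zero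
      (fun x hx hm y hy => h.rows x hx (hx.trans_le hv) hm y hy) u (Finset.mem_range.1 hu)]
    simp

end Marking

namespace RealRAM

namespace Search

open PushRelabel (size vertex head)

/-! Variables: `2` the number of vertices, `3` and `4` the ends of the arc under treatment, `x` the
number of marks. The marks are in the integer array `a`. -/

/-- Go back to the first arc. -/
def rewind : Program := .seq (.setVar 3 (.lit 0)) (.setVar 4 (.lit 0))

/-- Mark the vertex `0`. -/
def start (a x : ℕ) : Program :=
  .seq (.setInt a (.lit 0) (.lit 1)) <| .seq (.setVar x (.lit 1)) rewind

/-- Whether the arc under treatment leads from a marked vertex to an unmarked one; its residual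
capacity is in the cell `c`. -/
def discovers (a : ℕ) (c : IExp) : Test :=
  .conj (.ile (.lit 1) (.get a vertex)) <|
  .conj (.ile (.get a head) (.lit 0)) (.neg (.rle (.get 4 c) .zero))

/-- One round of the search. -/
def round (a x : ℕ) (c : IExp) : Program :=
  .branch (.ile size head)
    (.seq (.setVar 3 (.add vertex (.lit 1))) (.setVar 4 (.lit 0))) <|
  .branch (discovers a c)
    (.seq (.setInt a head (.lit 1)) <| .seq (.setVar x (.add (.var x) (.lit 1))) rewind)
    (.setVar 4 (.add head (.lit 1)))

/-- The search program. -/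
def main (a x : ℕ) (c : IExp) : Program :=
  .seq (start a x) (.loop (.neg (.ile size vertex)) (round a x c))

theorem round_loopFree (a x : ℕ) (c : IExp) : (round a x c).LoopFree := by
  simp [round, rewind, Program.LoopFree]

/-- What the search leaves untouched. -/
structure Frame (a x : ℕ) (σ τ : State) : Prop where
  vars : ∀ y, y ≠ 3 → y ≠ 4 → y ≠ x → τ.vars y = σ.vars y
  ints : ∀ y, y ≠ a → τ.ints y = σ.ints y
  reals : τ.reals = σ.reals

/-- The loop invariant. -/
structure Inv (N : ℕ) (ρ : ℕ → ℕ → Prop) (a x : ℕ) (σ : State) (k : ℕ) (τ : State) : Prop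
    extends Frame a x σ τ where
  size : τ.vars 2 = N
  le : τ.vars 3 ≤ N
  marking : Marking N ρ (τ.ints a) (τ.vars x) (τ.vars 3) (τ.vars 4)
  rounds : k = (N - τ.vars x) * ((N + 1) * (N + 1)) + (N - τ.vars 3) * (N + 1) + (N - τ.vars 4)

variable {N : ℕ} {ρ : ℕ → ℕ → Prop} {a x : ℕ} {c : IExp} {σ : State}

/-- The measure reads unmarked vertices, remaining rows and remaining columns as digits in base `N +
1`: a discovery lowers the first digit and refills the other two to `N`, the end of a row lowers the
second and refills the third. The relation `ρ` is tied to the cell `c` only through `hρ`, so the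
same program searches along the arcs or against them. -/
theorem round_step (hx : 4 < x)
    (hρ : ∀ τ, Frame a x σ τ → τ.vars 3 < N → τ.vars 4 < N →
      (0 < τ.reals 4 (c.eval τ) ↔ ρ (τ.vars 3) (τ.vars 4)))
    {k : ℕ} {τ : State} (h : Inv N ρ a x σ k τ) (hv : τ.vars 3 < N) :
    ∃ k' < k, Inv N ρ a x σ k' ((round a x c).run τ) := by
  have hx₂ : 2 ≠ x := by omega
  have hx₃ : 3 ≠ x := by omega
  have hx₄ : 4 ≠ x := by omega
  obtain ⟨⟨hvars, hints, hreals⟩, hsize, hle, hmk, rfl⟩ := h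
  by_cases hw : N ≤ τ.vars 4
  · have hrun : (round a x c).run τ = (τ.putVar 3 (τ.vars 3 + 1)).putVar 4 0 := by
      simp [round, Program.run, Test.Holds, IExp.eval, size, vertex, head, hsize, hw]
    rw [hrun]
    refine ⟨_, ?_, ⟨fun y h₃ h₄ h => by simpa [h₃, h₄] using hvars y h₃ h₄ h, hints, hreals⟩,
      by simpa using hsize, by simpa using hv,
      by simpa [hx₃.symm, hx₄.symm] using hmk.nextRow hw, rfl⟩
    simp only [State.vars_putVar, hx₃.symm, hx₄.symm, if_true, if_false]
    obtain ⟨u, hu⟩ := Nat.exists_eq_add_of_lt hv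
    have h₁ : N - τ.vars 3 = u + 1 := by omega
    have h₂ : N - (τ.vars 3 + 1) = u := by omega
    simp only [show ¬ (3 : ℕ) = 4 by decide, if_false, h₁, h₂, Nat.add_mul u 1]
    omega
  · rw [not_le] at hw
    have hρ' := hρ τ ⟨hvars, hints, hreals⟩ hv hw
    have hdisc : (discovers a c).Holds τ ↔ τ.ints a (τ.vars 3) = 1 ∧
        τ.ints a (τ.vars 4) = 0 ∧ ρ (τ.vars 3) (τ.vars 4) := by
      have := hmk.le_one (τ.vars 3)
      have h₁ : 1 ≤ τ.ints a (τ.vars 3) ↔ τ.ints a (τ.vars 3) = 1 := by omega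
      simp only [discovers, Test.Holds, IExp.eval, RExp.eval, vertex, head, Nat.le_zero, not_le,
        hρ', h₁]
    by_cases hd : (discovers a c).Holds τ
    · have hrun : (round a x c).run τ = (((τ.putInt a (τ.vars 4) 1).putVar x
          (τ.vars x + 1)).putVar 3 0).putVar 4 0 := by
        simp [round, Program.run, Test.Holds, IExp.eval, size, head, hsize, hw.not_ge, hd, rewind]
      obtain ⟨h₁, h₂, h₃⟩ := hdisc.1 hd
      have hmk' := hmk.mark hv hw h₁ h₂ h₃
      rw [hrun]
      refine ⟨_, ?_, ⟨fun y h₃ h₄ h => by simpa [h₃, h₄, h] using hvars y h₃ h₄ h,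
        fun y hy => by simpa [hy] using hints y hy, hreals⟩,
        by simpa [hx₂] using hsize, by simp, by simpa [hx₃.symm, hx₄.symm] using hmk', rfl⟩
      simp only [State.vars_putVar, State.vars_putInt, hx₃.symm, hx₄.symm, if_true, if_false]
      have hle := hmk'.count_le
      obtain ⟨u, hu⟩ := Nat.exists_eq_add_of_le hle
      have h₁ : N - τ.vars x = u + 1 := by omega
      have h₂ : N - (τ.vars x + 1) = u := by omega
      simp only [show ¬ (3 : ℕ) = 4 by decide, if_false, h₁, h₂, Nat.sub_zero, Nat.add_mul u 1,
        Nat.mul_add (N + 1)]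
      have : N * (N + 1) = (N + 1) * N := Nat.mul_comm _ _
      omega
    · have hrun : (round a x c).run τ = τ.putVar 4 (τ.vars 4 + 1) := by
        simp [round, Program.run, Test.Holds, IExp.eval, size, head, hsize, hw.not_ge, hd]
      rw [hrun]
      refine ⟨_, ?_, ⟨fun y h₃ h₄ h => by simpa [h₄] using hvars y h₃ h₄ h, hints, hreals⟩,
        by simpa using hsize, by simpa using hle, ?_, rfl⟩
      · simp only [State.vars_putVar, hx₄.symm, if_true, if_false]
        simp only [show ¬ (3 : ℕ) = 4 by decide, if_false]
        omega
      · have := hmk.nextArc fun h₁ h₃ => by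
          by_contra h₂
          have := hmk.le_one (τ.vars 4)
          exact hd (hdisc.2 ⟨h₁, by omega, h₃⟩)
        simpa [hx₄.symm] using this

/-- The search decides whether every closed set that contains `0` contains all vertices. -/
theorem main_reaches (hN : 0 < N) (hx : 4 < x) (hσ : σ.vars 2 = N) (ha : σ.ints a = 0)
    (hρ : ∀ τ, Frame a x σ τ → τ.vars 3 < N → τ.vars 4 < N →
      (0 < τ.reals 4 (c.eval τ) ↔ ρ (τ.vars 3) (τ.vars 4))) :
    (main a x c).Reaches σ
      ((start a x).time + ((N + 1) * ((N + 1) * (N + 1)) + 1) * (5 + (round a x c).time))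
      fun τ => Frame a x σ τ ∧ (τ.vars x = N ↔ Spans N ρ) := by
  have hx₂ : 2 ≠ x := by omega
  have hx₃ : 3 ≠ x := by omega
  have hx₄ : 4 ≠ x := by omega
  have hstart : (start a x).LoopFree := by simp [start, rewind, Program.LoopFree]
  refine Program.Reaches.seq (hstart.reaches
    (Q := fun τ => ∃ k ≤ (N + 1) * ((N + 1) * (N + 1)), Inv N ρ a x σ k τ) ?_) ?_
  · have hrun : (start a x).run σ = (((σ.putInt a 0 1).putVar x 1).putVar 3 0).putVar 4 0 := rfl
    rw [hrun]
    refine ⟨_, ?_, ⟨fun y h₃ h₄ h => by simp [h₃, h₄, h],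
        fun y hy => by simp [hy], rfl⟩, by simpa [hx₂] using hσ, by simp, ?_, rfl⟩
    · simp only [State.vars_putVar, State.vars_putInt, hx₃.symm, hx₄.symm, if_true, if_false,
        show ¬ (3 : ℕ) = 4 by decide, Nat.sub_zero]
      have h₁ : (N - 1) * ((N + 1) * (N + 1)) ≤ N * ((N + 1) * (N + 1)) :=
        Nat.mul_le_mul_right _ (Nat.sub_le _ _)
      rw [Nat.add_mul N 1 ((N + 1) * (N + 1)), Nat.add_mul N 1 (N + 1)] at *
      omega
    · have h₁ : Marking N ρ (Function.update 0 0 1) 1 0 0 := by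
        refine ⟨by simp, fun u => ?_, ?_, fun X h₀ _ u _ hu => ?_, by simp, by simp⟩
        · rcases eq_or_ne u 0 with rfl | hu
          · simp
          · simp [hu]
        · rw [Finset.sum_update_of_mem (Finset.mem_range.2 hN)]
          simp
        · rcases eq_or_ne u 0 with rfl | hu'
          · exact h₀
          · simp [hu'] at hu
      simpa [hx₃.symm, hx₄.symm, ha] using h₁
  · rintro τ ⟨k, hk, hτ⟩
    obtain ⟨t, τ', ht, hT, hτ', k', h'⟩ := (round_loopFree a x c).loop_reaches
      (b := .neg (.ile size vertex)) (I := Inv N ρ a x σ) (fun k τ h hb => by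
        have hb' : τ.vars 3 < N := by
          simpa [Test.Holds, IExp.eval, size, vertex, h.size] using hb
        exact round_step hx hρ h hb') hτ
    refine ⟨t, τ', ht, hT.trans (Nat.mul_le_mul_right _ (Nat.succ_le_succ hk)), h'.toFrame,
      h'.marking.count_eq_iff ?_⟩
    simpa [Test.Holds, IExp.eval, size, vertex, h'.size] using hτ'

end Search


theorem Program.Reaches.mono {P : Program} {σ : State} {T T' : ℕ} {Q Q' : State → Prop}
    (h : P.Reaches σ T Q) (hT : T ≤ T') (hQ : ∀ τ, Q τ → Q' τ) : P.Reaches σ T' Q' :=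
  let ⟨t, τ, ht, htT, hτ⟩ := h
  ⟨t, τ, ht, htT.trans hT, hQ τ hτ⟩

/-! ## Loading the input -/

/-- Run through the entries of an `n × m` matrix; the variables `3`, `4`, `5` hold the row, the
column and the cell. -/
def gridRound (P : Program) : Program :=
  .branch (.ile (.var 1) (.var 4))
    (.seq (.setVar 3 (.add (.var 3) (.lit 1))) (.setVar 4 (.lit 0)))
    (.seq P (.seq (.setVar 4 (.add (.var 4) (.lit 1))) (.setVar 5 (.add (.var 5) (.lit 1)))))

/-- Execute `P` for all entries of an `n × m` matrix. -/
def grid (P : Program) : Program :=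
  .seq (.seq (.setVar 3 (.lit 0)) (.seq (.setVar 4 (.lit 0)) (.setVar 5 (.lit 0))))
    (.loop (.neg (.ile (.var 0) (.var 3))) (gridRound P))

/-- `I i j` describes the memory just before entry `(i, j)`, and `row` identifies the end of a row
with the start of the next. A counter follows the cell `i * m + j`, as the machine cannot multiply.
-/
theorem grid_reaches {P : Program} (hP : P.LoopFree) {n m : ℕ} {I : ℕ → ℕ → State → Prop}
    (hn : ∀ i j σ, I i j σ → σ.vars 0 = n) (hm : ∀ i j σ, I i j σ → σ.vars 1 = m)
    (put : ∀ i j σ x v, 3 ≤ x → x ≤ 5 → I i j σ → I i j (σ.putVar x v))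
    (step : ∀ i < n, ∀ j < m, ∀ σ, I i j σ → σ.vars 3 = i → σ.vars 4 = j → σ.vars 5 = i * m + j →
      I i (j + 1) (P.run σ) ∧ (P.run σ).vars = σ.vars)
    (row : ∀ i < n, ∀ σ, I i m σ → I (i + 1) 0 σ) {σ : State} (hσ : I 0 0 σ) :
    (grid P).Reaches σ (6 + (n * (m + 1) + m + 1) * (5 + (gridRound P).time)) (I n 0) := by
  refine Program.Reaches.seq (Program.LoopFree.reaches (by simp [Program.LoopFree])
    (Q := fun τ => I 0 0 τ ∧ τ.vars 3 = 0 ∧ τ.vars 4 = 0 ∧ τ.vars 5 = 0) ?_) ?_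
  · refine ⟨?_, by simp [Program.run, IExp.eval]⟩
    exact put _ _ _ _ _ (by norm_num) le_rfl
      (put _ _ _ _ _ (by norm_num) (by norm_num) (put _ _ _ _ _ le_rfl (by norm_num) hσ))
  rintro τ ⟨hI, h₃, h₄, h₅⟩
  have hloop : (gridRound P).LoopFree := by simp [gridRound, Program.LoopFree, hP]
  obtain ⟨t, τ', ht, hT, hτ', k', i, j, h'⟩ := hloop.loop_reaches
    (b := .neg (.ile (.var 0) (.var 3)))
    -- Each row takes `m + 1` rounds, the last one for the change of row. The clause `i = n → j = 0`
    -- makes the exit state satisfy `I n 0`.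
    (I := fun k σ => ∃ i j, I i j σ ∧ i ≤ n ∧ j ≤ m ∧ (i = n → j = 0) ∧ σ.vars 3 = i ∧
      σ.vars 4 = j ∧ σ.vars 5 = i * m + j ∧ k = (n - i) * (m + 1) + (m - j))
    (k := n * (m + 1) + m) (σ := τ) (by
      rintro k σ ⟨i, j, hI, hi, hj, -, h₃, h₄, h₅, rfl⟩ hb
      have hi' : i < n := by simpa [Test.Holds, IExp.eval, hn i j σ hI, h₃] using hb
      obtain ⟨u, hu⟩ := Nat.exists_eq_add_of_lt hi'
      have h₁ : n - i = u + 1 := by omega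
      have h₂ : n - (i + 1) = u := by omega
      by_cases hjm : m ≤ j
      · obtain rfl : j = m := le_antisymm hj hjm
        have hrun : (gridRound P).run σ = (σ.putVar 3 (i + 1)).putVar 4 0 := by
          simp [gridRound, Program.run, Test.Holds, IExp.eval, hm i j σ hI, h₃, h₄]
        rw [hrun]
        refine ⟨_, ?_, i + 1, 0, put _ _ _ _ _ (by norm_num) (by norm_num)
          (put _ _ _ _ _ (by norm_num) (by norm_num) (row i hi' σ hI)), hi', Nat.zero_le _,
          fun _ => rfl, by simp, by simp, ?_, rfl⟩
        · rw [h₁, h₂, Nat.add_mul u 1]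
          omega
        · simpa [Nat.add_mul] using h₅
      · have hjm' := not_le.1 hjm
        obtain ⟨hI', hv⟩ := step i hi' j hjm' σ hI h₃ h₄ h₅
        have hrun : (gridRound P).run σ =
            ((P.run σ).putVar 4 (j + 1)).putVar 5 (i * m + j + 1) := by
          simp [gridRound, Program.run, Test.Holds, IExp.eval, hm i j σ hI, h₄, h₅, hv, hjm]
        rw [hrun]
        refine ⟨_, ?_, i, j + 1, put _ _ _ _ _ (by norm_num) (by norm_num)
          (put _ _ _ _ _ (by norm_num) (by norm_num) hI'), hi, hjm',
          fun h => absurd h hi'.ne, by simpa [hv] using h₃, by simp, by simp [Nat.add_assoc], rfl⟩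
        omega)
    ⟨0, 0, hI, Nat.zero_le _, Nat.zero_le _, fun _ => rfl, h₃, h₄, by simpa using h₅, rfl⟩
  obtain ⟨hI', hi, -, hij, h₃, -⟩ := h'
  have hin : i = n := by
    refine le_antisymm hi ?_
    simpa [Test.Holds, IExp.eval, hn i j τ' hI', h₃] using hτ'
  rw [hij hin, hin] at hI'
  exact ⟨t, τ', ht, hT, hI'⟩

/-! ### Marginals, supplies and capacities in memory -/

variable {n m : ℕ} {E : ℕ → ℕ → Prop} {p q : ℕ → ℝ} {σ : State}

/-- The memory before the start: a graph and two vectors, and zeros in the working arrays. -/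
structure Loaded (n m : ℕ) (E : ℕ → ℕ → Prop) (p q : ℕ → ℝ) (σ : State) : Prop where
  rows : σ.vars 0 = n
  columns : σ.vars 1 = m
  edges : ∀ i < n, ∀ j < m, 1 ≤ σ.ints 0 (i * m + j) ↔ E i j
  left : ∀ i < n, σ.reals 0 i = p i
  right : ∀ j < m, σ.reals 1 j = q j
  ints : ∀ a, 2 ≤ a → σ.ints a = 0
  reals : σ.reals 4 = 0

/-- Add up the rows and the columns of the matrix in the real array `2`. -/
def addEntry : Program :=
  .seq (.setReal 0 (.var 3) (.add (.get 0 (.var 3)) (.get 2 (.var 5))))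
    (.setReal 1 (.var 4) (.add (.get 1 (.var 4)) (.get 2 (.var 5))))

theorem marginals_reaches {M : ℕ → ℕ → ℝ} (h : Loaded n m E 0 0 σ) (h₀ : σ.reals 0 = 0)
    (h₁ : σ.reals 1 = 0) (hM : ∀ i < n, ∀ j < m, σ.reals 2 (i * m + j) = M i j) :
    (grid addEntry).Reaches σ (6 + (n * (m + 1) + m + 1) * (5 + (gridRound addEntry).time))
      (Loaded n m E (fun i => ∑ j ∈ Finset.range m, M i j)
        fun j => ∑ i ∈ Finset.range n, M i j) := by
  have hloop : addEntry.LoopFree := by simp [addEntry, Program.LoopFree]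
  refine (grid_reaches hloop (n := n) (m := m) (I := fun i j τ =>
    τ.vars 0 = n ∧ τ.vars 1 = m ∧ τ.ints = σ.ints ∧ τ.reals 2 = σ.reals 2 ∧ τ.reals 4 = 0 ∧
    (∀ x < n, τ.reals 0 x = ∑ y ∈ Finset.range (if x < i then m else if x = i then j else 0),
      M x y) ∧
    ∀ y < m, τ.reals 1 y = ∑ x ∈ Finset.range (if y < j then i + 1 else i), M x y)
    (fun i j τ h => h.1) (fun i j τ h => h.2.1) ?_ ?_ ?_ ?_).mono le_rfl ?_
  · rintro i j τ x v hx hx' ⟨hn, hm, hr⟩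
    refine ⟨?_, ?_, hr⟩
    · simpa [show 0 ≠ x by omega] using hn
    · simpa [show 1 ≠ x by omega] using hm
  · rintro i hi j hj τ ⟨hn, hm, hints, hr₂, hr₄, hr₀, hr₁⟩ h₃ h₄ h₅
    have hrun : addEntry.run τ = (τ.putReal 0 i (τ.reals 0 i + M i j)).putReal 1 j
        (τ.reals 1 j + M i j) := by
      simp [addEntry, Program.run, IExp.eval, RExp.eval, h₃, h₄, h₅, hr₂, hM i hi j hj]
    rw [hrun]
    refine ⟨⟨hn, hm, hints, by simpa using hr₂, by simpa using hr₄, fun x hx => ?_,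
      fun y hy => ?_⟩, rfl⟩
    · have hx' := hr₀ x hx
      rcases eq_or_ne x i with rfl | hxi
      · simp only [lt_irrefl, if_false, if_true] at hx' ⊢
        simp [hx', Finset.sum_range_succ]
      · simpa [hxi] using hx'
    · have hy' := hr₁ y hy
      rcases eq_or_ne y j with rfl | hyj
      · simp only [lt_irrefl, if_false] at hy'
        simp [hy', Finset.sum_range_succ]
      · have : y < j + 1 ↔ y < j := by omega
        simpa [hyj, this] using hy'
  · rintro i hi τ ⟨hn, hm, hints, hr₂, hr₄, hr₀, hr₁⟩
    refine ⟨hn, hm, hints, hr₂, hr₄, fun x hx => ?_, fun y hy => ?_⟩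
    · rw [hr₀ x hx]
      congr 2
      split_ifs <;> omega
    · rw [hr₁ y hy]
      simp [hy]
  · exact ⟨h.rows, h.columns, rfl, rfl, h.reals, by simp [h₀], by simp [h₁]⟩
  · rintro τ ⟨hn, hm, hints, -, hr₄, hr₀, hr₁⟩
    refine ⟨hn, hm, ?_, fun i hi => ?_, fun j hj => ?_, ?_, hr₄⟩
    · rw [hints]
      exact h.edges
    · rw [hr₀ i hi, if_pos hi]
    · rw [hr₁ j hj]
      simp
    · rw [hints]
      exact h.ints

/-- The supplies of the vertices `0, …, n + m - 1`. -/
def supplyOf (n : ℕ) (p q : ℕ → ℝ) (v : ℕ) : ℝ := if n ≤ v then 0 - q (v - n) else p v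

open Classical in
/-- The capacities of the arcs between the vertices `0, …, n + m - 1`. -/
noncomputable def capacityOf (n : ℕ) (E : ℕ → ℕ → Prop) (v w : ℕ) : ℝ :=
  if v < n ∧ n ≤ w ∧ E v (w - n) then 2 else 0

/-- Set the offset and the supply of the vertex in the variable `3`. -/
def vertexRound : Program :=
  .seq (.branch (.ile (.var 0) (.var 3))
    (.setReal 3 (.var 3) (.sub .zero (.get 1 (.sub (.var 3) (.var 0)))))
    (.setReal 3 (.var 3) (.get 0 (.var 3)))) <|
  .seq (.setInt 1 (.var 3) (.var 5)) <|
  .seq (.setVar 5 (.add (.var 5) (.var 2))) (.setVar 3 (.add (.var 3) (.lit 1)))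

/-- Set the offsets and the supplies. -/
def loadVertices : Program :=
  .seq (.seq (.setVar 2 (.add (.var 0) (.var 1))) (.seq (.setVar 3 (.lit 0)) (.setVar 5 (.lit 0))))
    (.loop (.neg (.ile (.var 2) (.var 3))) vertexRound)

/-- The memory after the offsets and the supplies were set. -/
structure VerticesLoaded (n m : ℕ) (E : ℕ → ℕ → Prop) (p q : ℕ → ℝ) (σ : State) : Prop
    extends Loaded n m E p q σ where
  size : σ.vars 2 = n + m
  offset : ∀ v < n + m, σ.ints 1 v = v * (n + m)
  supply : ∀ v < n + m, σ.reals 3 v = supplyOf n p q v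

/-- The products `v * (n + m)` arise by repeated addition; once tabulated, they make every arc
addressable without multiplication. -/
theorem loadVertices_reaches (h : Loaded n m E p q σ) :
    loadVertices.Reaches σ (8 + (n + m + 1) * (5 + vertexRound.time))
      (VerticesLoaded n m E p q) := by
  refine Program.Reaches.seq (Program.LoopFree.reaches (by simp [Program.LoopFree])
    (Q := fun τ => Loaded n m E p q τ ∧ τ.vars 2 = n + m ∧ τ.vars 3 = 0 ∧ τ.vars 5 = 0) ?_) ?_
  · simp only [Program.run, IExp.eval]
    exact ⟨⟨by simpa using h.rows, by simpa using h.columns, h.edges, h.left, h.right, h.ints,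
      h.reals⟩, by simp [h.rows, h.columns], by simp, by simp⟩
  rintro τ ⟨hτ, h₂, h₃, h₅⟩
  have hloop : vertexRound.LoopFree := by simp [vertexRound, Program.LoopFree]
  obtain ⟨t, τ', ht, hT, hτ', k', h', h₂, h₃, -, h₅, h₆, -⟩ := hloop.loop_reaches
    (b := .neg (.ile (.var 2) (.var 3)))
    (I := fun k σ => Loaded n m E p q σ ∧ σ.vars 2 = n + m ∧ σ.vars 3 ≤ n + m ∧
      σ.vars 5 = σ.vars 3 * (n + m) ∧ (∀ v < σ.vars 3, σ.ints 1 v = v * (n + m)) ∧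
      (∀ v < σ.vars 3, σ.reals 3 v = supplyOf n p q v) ∧ k = n + m - σ.vars 3)
    (k := n + m) (σ := τ) (by
      rintro k σ ⟨h, h₂, h₃, h₅, hi, hr, rfl⟩ hb
      have hv : σ.vars 3 < n + m := by simpa [Test.Holds, IExp.eval, h₂] using hb
      have hrun : vertexRound.run σ = (((σ.putReal 3 (σ.vars 3)
          (supplyOf n p q (σ.vars 3))).putInt 1 (σ.vars 3) (σ.vars 3 * (n + m))).putVar 5
          (σ.vars 3 * (n + m) + (n + m))).putVar 3 (σ.vars 3 + 1) := by
        by_cases hn : n ≤ σ.vars 3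
        · simp [vertexRound, Program.run, Test.Holds, IExp.eval, RExp.eval, h.rows, h₂, h₅, hn,
            supplyOf, h.right (σ.vars 3 - n) (by omega)]
        · simp [vertexRound, Program.run, Test.Holds, IExp.eval, h.rows, RExp.eval, h₂, h₅, hn,
            supplyOf, h.left (σ.vars 3) (not_le.1 hn)]
      rw [hrun]
      refine ⟨_, ?_, ⟨by simpa using h.rows, by simpa using h.columns, by simpa using h.edges,
        by simpa using h.left, by simpa using h.right, fun a ha => ?_, by simpa using h.reals⟩,
        by simpa using h₂, by simpa using hv, by simp [Nat.add_mul], fun v hv' => ?_,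
        fun v hv' => ?_, rfl⟩
      · simp only [State.vars_putVar, if_true]
        omega
      · simpa [show a ≠ 1 by omega] using h.ints a ha
      · simp only [State.vars_putVar, if_true] at hv'
        rcases eq_or_ne v (σ.vars 3) with rfl | hne
        · simp
        · simpa [hne] using hi v (by omega)
      · simp only [State.vars_putVar, if_true] at hv'
        rcases eq_or_ne v (σ.vars 3) with rfl | hne
        · simp
        · simpa [hne] using hr v (by omega))
    ⟨hτ, h₂, by omega, by simp [h₃, h₅], by simp [h₃], by simp [h₃], by simp [h₃]⟩
  have hv : n + m ≤ τ'.vars 3 := by simpa [Test.Holds, IExp.eval, h₂] using hτ'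
  exact ⟨t, τ', ht, hT, h', h₂, fun v hv' => h₅ v (by omega), fun v hv' => h₆ v (by omega)⟩

/-- Set the capacity of an edge. -/
def setCapacity : Program :=
  .branch (.ile (.lit 1) (.get 0 (.var 5)))
    (.setReal 4 (PushRelabel.arc (.var 3) (.add (.var 0) (.var 4))) (.add .one .one)) .skip

/-- The memory after the capacities were set. -/
structure NetworkLoaded (n m : ℕ) (E : ℕ → ℕ → Prop) (p q : ℕ → ℝ) (σ : State) : Prop where
  size : σ.vars 2 = n + m
  offset : ∀ v < n + m, σ.ints 1 v = v * (n + m)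
  supply : ∀ v < n + m, σ.reals 3 v = supplyOf n p q v
  capacity : ∀ v < n + m, ∀ w < n + m, PushRelabel.res (n + m) σ v w = capacityOf n E v w
  ints : ∀ a, 2 ≤ a → σ.ints a = 0

theorem loadEdges_reaches (h : VerticesLoaded n m E p q σ) :
    (grid setCapacity).Reaches σ
      (6 + (n * (m + 1) + m + 1) * (5 + (gridRound setCapacity).time))
      (NetworkLoaded n m E p q) := by
  classical
  have hloop : setCapacity.LoopFree := by simp [setCapacity, Program.LoopFree]
  refine (grid_reaches hloop (n := n) (m := m) (I := fun i j τ =>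
    τ.vars 0 = n ∧ τ.vars 1 = m ∧ τ.vars 2 = n + m ∧ τ.ints = σ.ints ∧ τ.reals 3 = σ.reals 3 ∧
    -- Server type `j` is the vertex `n + j`, hence the shift. Columns below `n` and rows from `n`
    -- on are not visited: their capacities are zero.
    ∀ x < n + m, ∀ y < n + m, PushRelabel.res (n + m) τ x y =
      if x < i ∨ x = i ∧ y < n + j then capacityOf n E x y else 0)
    (fun i j τ h => h.1) (fun i j τ h => h.2.1) ?_ ?_ ?_ ?_).mono le_rfl ?_
  · rintro i j τ x v hx hx' ⟨h₀, h₁, h₂, hr⟩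
    refine ⟨?_, ?_, ?_, hr⟩
    · simpa [show 0 ≠ x by omega] using h₀
    · simpa [show 1 ≠ x by omega] using h₁
    · simpa [show 2 ≠ x by omega] using h₂
  · rintro i hi j hj τ ⟨h₀, h₁, h₂, hints, hr₃, hr⟩ h₃ h₄ h₅
    have hE := h.edges i hi j hj
    have hcap : capacityOf n E i (n + j) = if E i j then 2 else 0 := by simp [capacityOf, hi]
    by_cases hij : E i j
    · have hrun : setCapacity.run τ = τ.putReal 4 (i * (n + m) + (n + j)) 2 := by
        simp [setCapacity, Program.run, Test.Holds, IExp.eval, RExp.eval, PushRelabel.arc, h₀, h₃,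
          h₄, h₅, hints, hE.2 hij, h.offset i (by omega), one_add_one_eq_two]
      rw [hrun]
      refine ⟨⟨h₀, h₁, h₂, hints, by simpa using hr₃, fun x hx y hy => ?_⟩, rfl⟩
      by_cases hxy : x = i ∧ y = n + j
      · obtain ⟨rfl, rfl⟩ := hxy
        rw [if_pos (.inr ⟨rfl, by omega⟩), hcap, if_pos hij]
        simp [PushRelabel.res]
      · have h₆ : x * (n + m) + y ≠ i * (n + m) + (n + j) := fun hcon =>
          hxy (PushRelabel.cell_inj hy (by omega) hcon)
        have h₇ : (x < i ∨ x = i ∧ y < n + (j + 1)) ↔ (x < i ∨ x = i ∧ y < n + j) := by omega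
        simp only [h₇, ← hr x hx y hy]
        simp [PushRelabel.res, h₆]
    · have hrun : setCapacity.run τ = τ := by
        have : ¬ 1 ≤ σ.ints 0 (i * m + j) := fun hcon => hij (hE.1 hcon)
        simp only [setCapacity, Program.run, Test.Holds, IExp.eval, h₅, hints, this, if_false]
      rw [hrun]
      refine ⟨⟨h₀, h₁, h₂, hints, hr₃, fun x hx y hy => ?_⟩, rfl⟩
      rw [hr x hx y hy]
      by_cases hxy : x = i ∧ y = n + j
      · obtain ⟨rfl, rfl⟩ := hxy
        simp [hcap, hij]
      · have h₇ : (x < i ∨ x = i ∧ y < n + (j + 1)) ↔ (x < i ∨ x = i ∧ y < n + j) := by omega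
        simp only [h₇]
  · rintro i hi τ ⟨h₀, h₁, h₂, hints, hr₃, hr⟩
    refine ⟨h₀, h₁, h₂, hints, hr₃, fun x hx y hy => ?_⟩
    rw [hr x hx y hy]
    by_cases hx' : x < i + 1
    · rw [if_pos (by omega), if_pos (by omega)]
    · rw [if_neg (by omega)]
      split_ifs with h₁
      · have : ¬ n ≤ y := by omega
        simp [capacityOf, this]
      · rfl
  · refine ⟨h.rows, h.columns, h.size, rfl, rfl, fun x hx y hy => ?_⟩
    rw [PushRelabel.res, h.reals]
    split_ifs with h₁
    · have : ¬ n ≤ y := by omega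
      simp [capacityOf, this]
    · rfl
  · rintro τ ⟨h₀, h₁, h₂, hints, hr₃, hr⟩
    refine ⟨h₂, ?_, ?_, fun v hv w hw => ?_, ?_⟩
    · rw [hints]
      exact h.offset
    · rw [hr₃]
      exact h.supply
    · rw [hr v hv w hw]
      by_cases hv' : v < n
      · rw [if_pos (.inl hv')]
      · have : capacityOf n E v w = 0 := by simp [capacityOf, hv']
        simp [this]
    · rw [hints]
      exact h.ints


/-! ## The decision procedure -/

section Outcome

variable {C S : Type*} {E : Set (C × S)} {p : C → ℝ} {q : S → ℝ} {N : ℕ} {φ : C ⊕ S ≃ Fin N}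
  {b e : ℕ → ℝ} {r₀ r : ℕ → ℕ → ℝ} {d cur : ℕ → ℕ}

theorem residual_symm (hr₀ : ∀ x y, r₀ (φ x) (φ y) = capacity E x y)
    (h : Labelled N b r₀ e r d cur) (x y : C ⊕ S) :
    r (φ x) (φ y) + r (φ y) (φ x) = capacity E x y + capacity E y x := by
  rw [← hr₀, ← hr₀]
  exact h.symm _ (φ x).2 _ (φ y).2

variable [Fintype C] [Fintype S]

theorem excess_eq (hb : ∀ x, b (φ x) = supply p q x)
    (hr₀ : ∀ x y, r₀ (φ x) (φ y) = capacity E x y)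
    (h : Labelled N b r₀ e r d cur) (x : C ⊕ S) :
    e (φ x) = supply p q x - ∑ y, (capacity E x y - r (φ x) (φ y)) := by
  rw [h.excess _ (φ x).2, hb, Finset.sum_range, ← φ.sum_comp]
  simp only [hr₀]

/-- When a label reaches `N`, NCond fails. -/
theorem not_nCond_of_label (hb : ∀ x, b (φ x) = supply p q x)
    (hr₀ : ∀ x y, r₀ (φ x) (φ y) = capacity E x y)
    (h : Labelled N b r₀ e r d cur)
    (hE : (bipartiteGraph E).Connected) (hp : p ∈ stdSimplex ℝ C)
    (hq : q ∈ stdSimplex ℝ S) (hq' : Function.support q = Set.univ)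
    {v : ℕ} (hv : v < N) (he : 0 < e v) (hd : N ≤ d v) : ¬ NCond E p q := by
  classical
  obtain ⟨X, hvX, hX, hX'⟩ := h.exists_closed hv hd
  obtain ⟨x₀, hx₀⟩ := φ.surjective ⟨v, hv⟩
  refine not_nCond_of_closed (r := fun x y => r (φ x) (φ y)) (e := fun x => e (φ x)) hE hp hq hq'
    (residual_symm hr₀ h) (excess_eq hb hr₀ h)
    (X := Finset.univ.filter fun x => (φ x : ℕ) ∈ X) (fun x hx y hy => ?_) (fun x hx => ?_)
    (.inl ⟨x₀, ?_, ?_⟩)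
  · rw [Finset.mem_filter_univ] at hx hy
    exact hX' _ (φ x).2 hx _ (φ y).2 hy
  · rw [Finset.mem_filter_univ] at hx
    exact hX _ (φ x).2 hx
  · simpa [hx₀] using hvX
  · simpa [hx₀] using he

/-- When no vertex is active, NCond means that the residual graph is strongly connected. -/
theorem nCond_iff_spans (hb : ∀ x, b (φ x) = supply p q x)
    (hr₀ : ∀ x y, r₀ (φ x) (φ y) = capacity E x y)
    (h : Labelled N b r₀ e r d cur)
    (hE : (bipartiteGraph E).Connected) (hp : p ∈ stdSimplex ℝ C)
    (hq : q ∈ stdSimplex ℝ S) (hq' : Function.support q = Set.univ) (hN : 0 < N)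
    (he : ∀ v < N, e v ≤ 0) :
    NCond E p q ↔ Spans N (fun v w => 0 < r v w) ∧ Spans N fun v w => 0 < r w v := by
  classical
  have hsymm := residual_symm hr₀ h
  have hexc := excess_eq hb hr₀ h
  have hr : ∀ x y, 0 ≤ r (φ x) (φ y) := fun x y => h.nonneg _ (φ x).2 _ (φ y).2
  have he' : ∀ x, e (φ x) ≤ 0 := fun x => he _ (φ x).2
  have hsurj : ∀ u (hu : u < N), ∃ x, (φ x : ℕ) = u := fun u hu =>
    (φ.surjective ⟨u, hu⟩).imp fun x hx => by rw [hx]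
  -- All excesses vanish here, so under NCond a closed set that contains some vertex contains all of
  -- them.
  have key : ∀ X : Set ℕ, (∀ x < N, x ∈ X → ∀ y < N, 0 < r x y → y ∈ X) → NCond E p q →
      ∀ v < N, v ∈ X → ∀ u < N, u ∈ X := by
    intro X hX hNC v hv hvX u hu
    by_contra huX
    obtain ⟨x, rfl⟩ := hsurj u hu
    obtain ⟨y, rfl⟩ := hsurj v hv
    refine not_nCond_of_closed hE hp hq hq' hsymm hexc
      (X := Finset.univ.filter fun x => (φ x : ℕ) ∈ X) (fun x hx y hy => ?_) (fun x _ => ?_)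
      (.inr ⟨⟨y, by simpa using hvX⟩, fun hcon => huX ?_⟩) hNC
    · rw [Finset.mem_filter_univ] at hx hy
      by_contra hne
      exact hy (hX _ (φ x).2 hx _ (φ y).2 (lt_of_le_of_ne (hr x y) (Ne.symm hne)))
    · exact (excess_eq_zero hp hq hsymm hexc he' x).ge
    · simpa using hcon.ge (Finset.mem_univ x)
  refine ⟨fun hNC => ⟨fun X h₀ hX => key X hX hNC 0 hN h₀, fun X h₀ hX u hu => ?_⟩,
    fun ⟨h₁, h₂⟩ => nCond_of_strongly_connected hE hp hq hq' hsymm hexc hr he'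
      fun Y hY hY₀ => ?_⟩
  -- The complement of a set closed under reversed arcs is closed under arcs; containing `u`, it
  -- would also contain `0`.
  · by_contra huX
    exact key Xᶜ (fun x hx hxX y hy hxy hyX => hxX (hX y hy hyX x hx hxy)) hNC u hu huX 0 hN h₀
  -- If the closed set `Y` contains vertex `0`, the forward search fills it. If not, its complement
  -- contains `0` and is closed under reversed arcs, which would make `Y` empty.
  · by_cases h₀ : ∃ x ∈ Y, (φ x : ℕ) = 0
    · refine Finset.eq_univ_of_forall fun y => ?_
      obtain ⟨x, hx, hxy⟩ := h₁ {v | ∃ x ∈ Y, (φ x : ℕ) = v} h₀ (by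
        rintro _ _ ⟨x, hx, rfl⟩ v hv hpos
        obtain ⟨y, rfl⟩ := hsurj v hv
        refine ⟨y, ?_, rfl⟩
        by_contra hy
        rw [hY x hx y hy] at hpos
        exact lt_irrefl _ hpos) (φ y) (φ y).2
      rwa [← φ.injective (Fin.ext hxy)]
    · obtain ⟨y, hy⟩ := hY₀
      refine absurd ⟨y, hy, rfl⟩ (h₂ {v | ∃ x ∈ Y, (φ x : ℕ) = v}ᶜ h₀ ?_ (φ y) (φ y).2)
      rintro v hv hvY _ - hpos ⟨x, hx, rfl⟩
      obtain ⟨y, rfl⟩ := hsurj v hv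
      have hy : y ∉ Y := fun hy => hvY ⟨y, hy, rfl⟩
      rw [hY x hx y hy] at hpos
      exact lt_irrefl _ hpos

end Outcome

open PushRelabel (vertex head arc)

/-- Prepare the first sweep. -/
def startSweep : Program :=
  .seq (.setVar 3 (.lit 0)) (.seq (.setVar 6 (.lit 0)) (.setVar 7 (.lit 1)))

/-- Whether no vertex is active and both searches have found all vertices. -/
def accepts : Test :=
  .conj (.ile (.lit 1) (.var 8)) <|
  .conj (.conj (.ile (.var 2) (.var 10)) (.ile (.var 10) (.var 2)))
    (.conj (.ile (.var 2) (.var 11)) (.ile (.var 11) (.var 2)))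

/-- Write the answer to the variable `0`. -/
def answer : Program := .branch accepts (.setVar 0 (.lit 1)) (.setVar 0 (.lit 0))

/-- The program that decides NCond for a graph and two marginals. -/
def decideNCond : Program :=
  .seq loadVertices <| .seq (grid setCapacity) <| .seq startSweep <| .seq PushRelabel.main <|
  .seq (Search.main 4 10 (arc vertex head)) <| .seq (Search.main 5 11 (arc head vertex)) answer

variable {n m : ℕ} {E : ℕ → ℕ → Prop} {p q : ℕ → ℝ} {σ : State}

/-! ### Correctness and cubic time of the decision program -/

theorem startSweep_reaches (h : NetworkLoaded n m E p q σ) (hN : 0 < n + m) :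
    startSweep.Reaches σ 6 (PushRelabel.Running (n + m) (supplyOf n p q) (capacityOf n E)
      (remaining (n + m) 0 0 0 0 + 1)) := by
  refine Program.LoopFree.reaches (P := startSweep) (by simp [startSweep, Program.LoopFree]) ?_
  have h₂ := h.ints 2 le_rfl
  have h₃ := h.ints 3 (by norm_num)
  have hl : Labelled (n + m) (supplyOf n p q) (capacityOf n E) (σ.reals 3)
      (PushRelabel.res (n + m) σ) (σ.ints 2) (σ.ints 3) := by
    refine ⟨fun v hv w hw => ?_, fun v hv w hw => ?_, fun v hv => ?_, fun v _ w _ _ => ?_,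
      fun v _ _ => ?_, fun v _ => ?_, fun v _ w hw => ?_⟩
    · rw [h.capacity v hv w hw, capacityOf]
      split_ifs <;> norm_num
    · rw [h.capacity v hv w hw, h.capacity w hw v hv]
    · rw [h.supply v hv, Finset.sum_eq_zero, sub_zero]
      intro w hw
      rw [h.capacity v hv w (Finset.mem_range.1 hw), sub_self]
    · simp [h₂]
    · simp [h₂]
    · simp [h₃]
    · simp [h₃] at hw
  have hrun : startSweep.run σ = ((σ.putVar 3 0).putVar 6 0).putVar 7 1 := rfl
  rw [hrun]
  -- All labels are zero at the start, so `H = 0` bounds them.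
  refine ⟨⟨by simpa using h.size, h.offset, by simpa using hl, h.ints 4 (by norm_num),
    h.ints 5 (by norm_num)⟩, fun v _ => by simpa [h₂] using hN, by simp, by simp, 0, ?_,
    by simp [h₂, h₃]⟩
  exact ⟨fun u _ _ _ => by simp [h₂], fun u _ hu => by simp at hu, fun _ u _ hu => by simp at hu,
    by simp⟩

/-- As `N > 0`, fixed costs are absorbed into the cubic term, so that the bounds of consecutive
phases simply add up to one constant. -/
theorem add_mul_le {N k x a : ℕ} (hN : 0 < N) (hx : x ≤ a * N ^ 3) (c : ℕ) :
    k + x * c ≤ (k + a * c) * N ^ 3 := by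
  have h₁ : k ≤ k * N ^ 3 := Nat.le_mul_of_pos_right _ (pow_pos hN 3)
  have h₂ := Nat.mul_le_mul_right c hx
  calc k + x * c ≤ k * N ^ 3 + a * N ^ 3 * c := Nat.add_le_add h₁ h₂
    _ = (k + a * c) * N ^ 3 := by ring

theorem grid_size_le (hN : 0 < n + m) : n * (m + 1) + m + 1 ≤ 3 * (n + m) ^ 3 := by
  have h₁ : n * m ≤ (n + m) * (n + m) :=
    Nat.mul_le_mul (Nat.le_add_right _ _) (Nat.le_add_left _ _)
  have h₂ : (n + m) * (n + m) ≤ (n + m) ^ 3 := by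
    rw [← sq]
    exact Nat.pow_le_pow_right hN (by norm_num)
  have h₃ : n + m ≤ (n + m) ^ 3 := Nat.le_self_pow (by norm_num) _
  rw [Nat.mul_succ]
  omega

theorem search_size_le {N : ℕ} (hN : 0 < N) :
    (N + 1) * ((N + 1) * (N + 1)) + 1 ≤ 9 * N ^ 3 := by
  have h₁ : N + 1 ≤ 2 * N := by omega
  have h₂ := Nat.mul_le_mul h₁ (Nat.mul_le_mul h₁ h₁)
  have h₃ : 0 < N ^ 3 := pow_pos hN 3
  have h₄ : 2 * N * (2 * N * (2 * N)) = 8 * N ^ 3 := by ring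
  omega

/-- The final memory, described by the flow that was found. -/
def Decided (n m : ℕ) (E : ℕ → ℕ → Prop) (p q : ℕ → ℝ) (τ : State) : Prop :=
  ∃ e r d cur, Labelled (n + m) (supplyOf n p q) (capacityOf n E) e r d cur ∧
    ((τ.vars 0 = 0 ∧ ∃ v < n + m, 0 < e v ∧ n + m ≤ d v) ∨
      ((∀ v < n + m, e v ≤ 0) ∧
        ((Spans (n + m) (fun v w => 0 < r v w) ∧ Spans (n + m) fun v w => 0 < r w v) ∧
            τ.vars 0 = 1 ∨
          ¬ (Spans (n + m) (fun v w => 0 < r v w) ∧ Spans (n + m) fun v w => 0 < r w v) ∧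
            τ.vars 0 = 0)))

/-- The searches run even after the flow phase has failed; variable `8` is then `0` and forces the
answer no, whatever they find. -/
theorem searches_reach {b : ℕ → ℝ} {r₀ : ℕ → ℕ → ℝ} {N : ℕ} (hN : 0 < N)
    (h : PushRelabel.Finished N b r₀ σ) :
    (Program.seq (Search.main 4 10 (arc vertex head))
      (.seq (Search.main 5 11 (arc head vertex)) answer)).Reaches σ
      ((((Search.start 4 10).time + 9 * (5 + (Search.round 4 10 (arc vertex head)).time)) +
        (((Search.start 5 11).time + 9 * (5 + (Search.round 5 11 (arc head vertex)).time)) +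
          answer.time)) * N ^ 3)
      fun τ => (σ.vars 8 = 1 ∧ Spans N (fun v w => 0 < PushRelabel.res N σ v w) ∧
          Spans N fun v w => 0 < PushRelabel.res N σ w v) ∧ τ.vars 0 = 1 ∨
        ¬ (σ.vars 8 = 1 ∧ Spans N (fun v w => 0 < PushRelabel.res N σ v w) ∧
          Spans N fun v w => 0 < PushRelabel.res N σ w v) ∧ τ.vars 0 = 0 := by
  rw [Nat.add_mul, Nat.add_mul _ answer.time]
  refine Program.Reaches.seq ((Search.main_reaches hN (by norm_num) h.size h.marks.1
    (ρ := fun v w => 0 < PushRelabel.res N σ v w) fun τ hτ hv hw => ?_).mono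
    (add_mul_le hN (search_size_le hN) _) fun _ => id) ?_
  · simp [arc, vertex, head, IExp.eval, PushRelabel.res, hτ.ints 1 (by norm_num), hτ.reals,
      h.offset _ hv]
  rintro τ ⟨hτ, hF⟩
  refine Program.Reaches.seq ((Search.main_reaches (N := N) hN (by norm_num)
    (by rw [hτ.vars 2 (by norm_num) (by norm_num) (by norm_num), h.size])
    (by rw [hτ.ints 5 (by norm_num), h.marks.2])
    (ρ := fun v w => 0 < PushRelabel.res N σ w v) fun τ' hτ' hv hw => ?_).mono
    (add_mul_le hN (search_size_le hN) _) fun _ => id) ?_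
  · simp [arc, vertex, head, IExp.eval, PushRelabel.res, hτ'.ints 1 (by norm_num),
      hτ.ints 1 (by norm_num), hτ'.reals, hτ.reals, h.offset _ hw]
  rintro τ' ⟨hτ', hB⟩
  have hloop : answer.LoopFree := by simp [answer, Program.LoopFree]
  refine (hloop.reaches ?_).mono (Nat.le_mul_of_pos_right _ (pow_pos hN 3)) fun _ => id
  have h₂ : τ'.vars 2 = N := by
    rw [hτ'.vars 2 (by norm_num) (by norm_num) (by norm_num),
      hτ.vars 2 (by norm_num) (by norm_num) (by norm_num), h.size]
  have h₈ : τ'.vars 8 = σ.vars 8 := by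
    rw [hτ'.vars 8 (by norm_num) (by norm_num) (by norm_num),
      hτ.vars 8 (by norm_num) (by norm_num) (by norm_num)]
  have h₁₀ : τ'.vars 10 = τ.vars 10 := hτ'.vars 10 (by norm_num) (by norm_num) (by norm_num)
  have h₈' : 1 ≤ σ.vars 8 ↔ σ.vars 8 = 1 := by
    rcases h.outcome with h | h <;> simp [h.1]
  have hacc : accepts.Holds τ' ↔ σ.vars 8 = 1 ∧
      Spans N (fun v w => 0 < PushRelabel.res N σ v w) ∧
        Spans N fun v w => 0 < PushRelabel.res N σ w v := by
    simp only [accepts, Test.Holds, IExp.eval, h₂, h₈, h₁₀, ← le_antisymm_iff, h₈',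
      eq_comm (a := N), hF, hB]
  simp only [answer, Program.run]
  split_ifs with hc
  · exact .inl ⟨hacc.1 hc, by simp [IExp.eval]⟩
  · exact .inr ⟨fun h => hc (hacc.2 h), by simp [IExp.eval]⟩

theorem decideNCond_reaches : ∃ K, ∀ (n m : ℕ) (E : ℕ → ℕ → Prop) (p q : ℕ → ℝ) (σ : State),
    Loaded n m E p q σ → 0 < n + m →
      decideNCond.Reaches σ (K * (n + m) ^ 3) (Decided n m E p q) := by
  refine ⟨(8 + 2 * (5 + vertexRound.time)) + ((6 + 3 * (5 + (gridRound setCapacity).time)) +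
    (6 + ((0 + 9 * (4 + PushRelabel.round.time)) +
    (((Search.start 4 10).time + 9 * (5 + (Search.round 4 10 (arc vertex head)).time)) +
    (((Search.start 5 11).time + 9 * (5 + (Search.round 5 11 (arc head vertex)).time)) +
      answer.time))))), fun n m E p q σ h hN => ?_⟩
  have hX : 0 < (n + m) ^ 3 := pow_pos hN 3
  have hle : n + m ≤ (n + m) ^ 3 := Nat.le_self_pow (by norm_num) _
  -- With `N = n + m`, the loop bound for push-relabel has the factor `remaining + 2 ≤ 6 N³ + N + 2
  -- ≤ 9 N³`.
  have hrem := remaining_zero_le (n + m)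
  refine Program.Reaches.mono (((loadVertices_reaches h).mono
    (add_mul_le (a := 2) hN (by omega) _) fun _ => id).seq fun σ h =>
    ((loadEdges_reaches h).mono (add_mul_le hN (grid_size_le hN) _) fun _ => id).seq fun σ h =>
    ((startSweep_reaches h hN).mono (Nat.le_mul_of_pos_right _ hX) fun _ => id).seq fun σ h =>
    ((PushRelabel.main_reaches h).mono ((Nat.zero_add _).ge.trans
      (add_mul_le (a := 9) hN (by omega) _)) fun _ => id).seq fun σ h =>
    (searches_reach hN h).mono le_rfl fun τ hτ => ?_) (le_of_eq ?_) fun _ => id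
  · refine ⟨_, _, _, _, h.labelled, ?_⟩
    rcases h.outcome with ⟨h₁, he⟩ | ⟨h₁, hv⟩
    · exact .inr ⟨he, by simpa [h₁] using hτ⟩
    · exact .inl ⟨by simpa [h₁] using hτ, hv⟩
  · ring

/-! ## The input -/

theorem vec_of_lt {α : Type*} [Zero α] {n : ℕ} (f : Fin n → α) {k : ℕ} (h : k < n) :
    vec f k = f ⟨k, h⟩ := dif_pos h

theorem mat_of_lt {α : Type*} [Zero α] {n m : ℕ} (f : Fin n → Fin m → α) {i j : ℕ}
    (hi : i < n) (hj : j < m) : mat f (i * m + j) = f ⟨i, hi⟩ ⟨j, hj⟩ := by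
  have h : ((finProdFinEquiv (⟨i, hi⟩, ⟨j, hj⟩) : Fin (n * m)) : ℕ) = i * m + j := by
    simp [finProdFinEquiv, Nat.mul_comm m, Nat.add_comm j]
  rw [mat, ← h, vec_of_lt _ (Fin.is_lt _)]
  simp only [Fin.eta, Equiv.symm_apply_apply]

variable {C S : Type*} [Fintype C] [Fintype S] (eC : Fin (Fintype.card C) ≃ C)
  (eS : Fin (Fintype.card S) ≃ S) (G : Set (C × S))

/-- The edges between numbered types. -/
def edgeOf (i j : ℕ) : Prop :=
  ∃ (hi : i < Fintype.card C) (hj : j < Fintype.card S), (eC ⟨i, hi⟩, eS ⟨j, hj⟩) ∈ G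

theorem edges_graphInput (reals : ℕ → ℕ → ℝ) {i j : ℕ} (hi : i < Fintype.card C)
    (hj : j < Fintype.card S) :
    1 ≤ (graphInput eC eS G reals).ints 0 (i * Fintype.card S + j) ↔ edgeOf eC eS G i j := by
  classical
  have h : (graphInput eC eS G reals).ints 0 (i * Fintype.card S + j) =
      mat (fun i j => if (eC i, eS j) ∈ G then 1 else 0) (i * Fintype.card S + j) := rfl
  rw [h, mat_of_lt _ hi hj, edgeOf]
  split_ifs with hG <;> simp [hG, hi, hj]

theorem loaded_graphInput (reals : ℕ → ℕ → ℝ) (h : reals 4 = 0) {p q : ℕ → ℝ}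
    (hp : ∀ i < Fintype.card C, reals 0 i = p i) (hq : ∀ j < Fintype.card S, reals 1 j = q j) :
    Loaded (Fintype.card C) (Fintype.card S) (edgeOf eC eS G) p q
      (graphInput eC eS G reals) where
  rows := rfl
  columns := rfl
  edges _ hi _ hj := edges_graphInput eC eS G reals hi hj
  left := hp
  right := hq
  ints a ha := by
    obtain ⟨a, rfl⟩ := Nat.exists_eq_add_of_le ha
    rw [Nat.add_comm]
    rfl
  reals := h

variable {eC eS G} {p : C → ℝ} {q : S → ℝ}

/-- The answer is correct. -/
theorem Decided.correct {p' q' : ℕ → ℝ} {τ : State}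
    (h : Decided (Fintype.card C) (Fintype.card S) (edgeOf eC eS G) p' q' τ)
    (hp' : ∀ i, p' (i : Fin (Fintype.card C)) = p (eC i))
    (hq' : ∀ j, q' (j : Fin (Fintype.card S)) = q (eS j))
    (hG : (bipartiteGraph G).Connected) (hp : p ∈ stdSimplex ℝ C) (hq : q ∈ stdSimplex ℝ S)
    (hqs : Function.support q = Set.univ) :
    (NCond G p q ∧ τ.vars 0 = 1) ∨ (¬ NCond G p q ∧ τ.vars 0 = 0) := by
  obtain ⟨e, r, d, cur, hl, h⟩ := h
  let φ : C ⊕ S ≃ Fin (Fintype.card C + Fintype.card S) :=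
    (Equiv.sumCongr eC.symm eS.symm).trans finSumFinEquiv
  have hφC : ∀ c, (φ (Sum.inl c) : ℕ) = eC.symm c := fun c => by simp [φ]
  have hφS : ∀ s, (φ (Sum.inr s) : ℕ) = Fintype.card C + eS.symm s := fun s => by simp [φ]
  have hb : ∀ x, supplyOf (Fintype.card C) p' q' (φ x) = supply p q x := by
    rintro (c | s)
    · rw [hφC, supplyOf, if_neg (not_le.2 (Fin.is_lt _)), hp']
      simp [supply]
    · rw [hφS, supplyOf, if_pos (Nat.le_add_right _ _), Nat.add_sub_cancel_left, hq']
      simp [supply]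
  have hr₀ : ∀ x y, capacityOf (Fintype.card C) (edgeOf eC eS G) (φ x) (φ y) = capacity G x y := by
    rintro (c | s) (c' | s')
    · rw [hφC, hφC, capacityOf, if_neg (by simp)]
      rfl
    · rw [hφC, hφS]
      have hedge : edgeOf eC eS G (eC.symm c) (Fintype.card C + eS.symm s' - Fintype.card C) ↔
          (c, s') ∈ G := by simp [edgeOf]
      by_cases hcs : (c, s') ∈ G
      · rw [capacityOf, capacity, if_pos ⟨Fin.is_lt _, Nat.le_add_right _ _, hedge.2 hcs⟩,
          if_pos hcs]
      · rw [capacityOf, capacity, if_neg fun h => hcs (hedge.1 h.2.2), if_neg hcs]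
    · rw [hφS, hφC, capacityOf, if_neg (by simp)]
      rfl
    · rw [hφS, hφS, capacityOf, if_neg (by simp)]
      rfl
  have hN : 0 < Fintype.card C + Fintype.card S :=
    Nat.add_pos_left (@Fintype.card_pos C _ (nonempty_of_mem_stdSimplex hp)) _
  rcases h with ⟨h₀, v, hv, hev, hd⟩ | ⟨he, h⟩
  · exact .inr ⟨not_nCond_of_label hb hr₀ hl hG hp hq hqs hv hev hd, h₀⟩
  · rwa [← nCond_iff_spans hb hr₀ hl hG hp hq hqs hN he] at h

end RealRAM

/-! ### Both forms of the input -/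

theorem mainTheorem9 :
    (∃ (P : RealRAM.Program) (K : ℕ),
      ∀ (C S : Type*) [Fintype C] [Fintype S] (M : BipartiteMatchingModel C S)
        (eC : Fin (Fintype.card C) ≃ C) (eS : Fin (Fintype.card S) ≃ S),
        P.DecidesWithin (RealRAM.jointInput eC eS M.E M.μ)
          (K * (Fintype.card C + Fintype.card S) ^ 3)
          (NCond M.E (marginalC M.μ) (marginalS M.μ))) ∧
    (∃ (P : RealRAM.Program) (K : ℕ),
      ∀ (C S : Type*) [Fintype C] [Fintype S] (E : Set (C × S)) (p : C → ℝ) (q : S → ℝ)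
        (eC : Fin (Fintype.card C) ≃ C) (eS : Fin (Fintype.card S) ≃ S),
        (bipartiteGraph E).Connected →
        p ∈ stdSimplex ℝ C → Function.support p = Set.univ →
        q ∈ stdSimplex ℝ S → Function.support q = Set.univ →
        P.DecidesWithin (RealRAM.marginalInput eC eS E p q)
          (K * (Fintype.card C + Fintype.card S) ^ 3)
          (NCond E p q)) := by
  obtain ⟨K, hK⟩ := RealRAM.decideNCond_reaches
  -- A joint law is reduced to its marginals by one pass over its matrix, which only enlarges the
  -- constant.
  refine ⟨⟨.seq (RealRAM.grid RealRAM.addEntry) RealRAM.decideNCond,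
    (6 + 3 * (5 + (RealRAM.gridRound RealRAM.addEntry).time)) + K,
    fun C S _ _ M eC eS => ?_⟩, RealRAM.decideNCond, K,
    fun C S _ _ E p q eC eS hE hp _ hq hq' => ?_⟩
  · have hμ := M.μ_mem
    have hp : marginalC M.μ ∈ stdSimplex ℝ C :=
      ⟨fun c => Finset.sum_nonneg fun s _ => hμ.1 _, by
        rw [← hμ.2, Fintype.sum_prod_type]
        rfl⟩
    have hq : marginalS M.μ ∈ stdSimplex ℝ S :=
      ⟨fun s => Finset.sum_nonneg fun c _ => hμ.1 _, by
        rw [← hμ.2, Fintype.sum_prod_type_right]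
        rfl⟩
    have hN : 0 < Fintype.card C + Fintype.card S :=
      Nat.add_pos_left (@Fintype.card_pos C _ M.nonempty_C) _
    have hM : ∀ i < Fintype.card C, ∀ j < Fintype.card S,
        (RealRAM.jointInput eC eS M.E M.μ).reals 2 (i * Fintype.card S + j) =
          RealRAM.mat (fun i j => M.μ (eC i, eS j)) (i * Fintype.card S + j) :=
      fun _ _ _ _ => rfl
    obtain ⟨t, τ, ht, hT, hτ⟩ := ((RealRAM.marginals_reaches (RealRAM.loaded_graphInput eC eS M.E
      _ rfl (fun _ _ => rfl) fun _ _ => rfl) rfl rfl hM).mono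
      (RealRAM.add_mul_le hN (RealRAM.grid_size_le hN) _) fun _ => id).seq
      fun σ hσ => hK _ _ _ _ _ σ hσ hN
    refine ⟨t, τ, ht, hT.trans_eq (Nat.add_mul _ _ _).symm, hτ.correct (fun i => ?_) (fun j => ?_)
      M.connected hp hq M.support_marginalS⟩
    · rw [Finset.sum_range, marginalC, ← eS.sum_comp]
      exact Finset.sum_congr rfl fun j _ => RealRAM.mat_of_lt _ i.2 j.2
    · rw [Finset.sum_range, marginalS, ← eC.sum_comp]
      exact Finset.sum_congr rfl fun i _ => RealRAM.mat_of_lt _ i.2 j.2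
  · have hN : 0 < Fintype.card C + Fintype.card S :=
      Nat.add_pos_left (@Fintype.card_pos C _ (nonempty_of_mem_stdSimplex hp)) _
    obtain ⟨t, τ, ht, hT, hτ⟩ := hK _ _ _ _ _ _ (RealRAM.loaded_graphInput eC eS E
      (fun | 0 => RealRAM.vec fun i => p (eC i) | 1 => RealRAM.vec fun j => q (eS j) | _ => 0)
      rfl (fun _ _ => rfl) fun _ _ => rfl) hN
    exact ⟨t, τ, ht, hT, hτ.correct (fun i => RealRAM.vec_of_lt _ i.2)
      (fun j => RealRAM.vec_of_lt _ j.2) hE hp hq hq'⟩
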